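/- For each $d\ge 1$ let $D_d\subset\mathbb R^d$, and assume that either $D_d=(0,1)^d$ for all $d$, or all $D_d$ are open convex sets of Lebesgue measure $1$ with small radius, i.e. $$\limsup_{d\to\infty}\frac{\mathrm{rad}(D_d)}{\sqrt d}<\sqrt{\frac{2}{\pi\mathrm e}},\qquad \mathrm{rad}(D_d)=\inf_{x\in\mathbb R^d}\sup_{y\in D_d}\|y-x\|_2 .$$ Let $k\in\mathbb N=\{1,2,\dots\}$, let $L_{j,d}>0$ for $0\le j\le k$ and $d\ge1$, and let $$\widetilde C_d^k(L)=\Bigl\{f\in C^k(D_d):\ \|f\|_\infty\le 1,\ \sup_{|\beta|=j}\mathrm{Lip}(D^\beta f)\le L_{j,d}\ \text{ for all } 0\le j\le k\Bigr\},$$ where $\mathrm{Lip}$ is the Lipschitz constant on $D_d$ with respect to the Euclidean norm. For a class $F_d$ of functions on $D_d$, let $n(\varepsilon,F_d)$ be the minimal number $n$ for which there is an algorithm $A(f)=\phi(f(x_1),\dots,f(x_n))$ with $\phi:\mathbb R^n\to\mathbb R$ arbitrary and points $x_i\in D_d$, where $x_i$ may depend on $f(x_1),\dots,f(x_{i-1})$,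 such that $\sup_{f\in F_d}\bigl|\int_{D_d}f(x)\,\mathrm dx-A(f)\bigr|\le\varepsilon$. The curse of dimensionality holds for $(F_d)$ if there are $c,\varepsilon_0,\gamma>0$ such that $n(\varepsilon,F_d)\ge c(1+\gamma)^d$ for all $0<\varepsilon\le\varepsilon_0$ and infinitely many $d$. (i) If the conditions $L_{0,d}\sqrt d\not\to0$ and $L_{j,d}\,d\not\to0$, $j=1,\dots,k$, hold jointly along a common subsequence of dimensions, i.e. if $$\limsup_{d\to\infty}\ \min\Bigl\{L_{0,d}\sqrt d,\ \min_{1\le j\le k}L_{j,d}\,d\Bigr\}>0,$$ then the curse of dimensionality holds for $\widetilde C_d^k(L)$. (ii) If $\lim_{d\to\infty}L_{j,d}\,d^{\,j+1/2}=0$ for some $j\in\{0,1,\dots,k\}$, then the curse of dimensionality does not hold for $\widetilde C_d^k(L)$. -/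

import Mathlib

open Filter Topology MeasureTheory Set
open scoped ENNReal

noncomputable section

namespace CurseIntegration

/-- `ℝ^d` with the Euclidean norm and Lebesgue measure. -/
abbrev E (d : ℕ) : Type := EuclideanSpace ℝ (Fin d)

/-! ### Algorithms and information complexity -/

/-- An adaptive algorithm using function values at points of `D`. The next sample point depends
on the list of values computed so far (hence also on how many values were computed), and the
output is an arbitrary function of the list of all computed values. -/
structure Algorithm {d : ℕ} (D : Set (E d)) where
  node : List ℝ → E d
  node_mem : ∀ v, node v ∈ D
  output : List ℝ → ℝ

/-- The list of the first `n` function values computed when the algorithm is applied to `f`. -/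
def Algorithm.values {d : ℕ} {D : Set (E d)} (A : Algorithm D) (f : E d → ℝ) : ℕ → List ℝ
  | 0 => []
  | n + 1 => A.values f n ++ [f (A.node (A.values f n))]

/-- The output of the algorithm after `n` function values. -/
def Algorithm.run {d : ℕ} {D : Set (E d)} (A : Algorithm D) (n : ℕ) (f : E d → ℝ) : ℝ :=
  A.output (A.values f n)

/-- The algorithm that stops after `n` function values has worst case error at most `ε` for the
integration over `D` of the functions in `F`. -/
def Algorithm.ErrorLE {d : ℕ} {D : Set (E d)} (A : Algorithm D) (n : ℕ)
    (F : Set (E d → ℝ)) (ε : ℝ) : Prop :=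
  ∀ f ∈ F, |(∫ x in D, f x) - A.run n f| ≤ ε

/-- The information complexity `n(ε, F)`: the minimal number of function values which is needed
to guarantee a worst case error at most `ε` (`⊤` if no number suffices). -/
def infoComplexity {d : ℕ} (D : Set (E d)) (F : Set (E d → ℝ)) (ε : ℝ) : ℕ∞ :=
  ⨅ n ∈ {n : ℕ | ∃ A : Algorithm D, A.ErrorLE n F ε}, (n : ℕ∞)

/-- The curse of dimensionality: there are positive `c`, `ε₀`, `γ` such that
`n(ε, F_d) ≥ c (1 + γ)^d` for all `0 < ε ≤ ε₀` and infinitely many `d`. -/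
def CurseOfDimensionality (D : ∀ d : ℕ, Set (E d)) (F : ∀ d : ℕ, Set (E d → ℝ)) : Prop :=
  ∃ c ε₀ γ : ℝ, 0 < c ∧ 0 < ε₀ ∧ 0 < γ ∧ ∀ ε : ℝ, 0 < ε → ε ≤ ε₀ →
    ∃ᶠ d : ℕ in atTop,
      ENNReal.ofReal (c * (1 + γ) ^ d) ≤ ((infoComplexity (D d) (F d) ε : ℕ∞) : ℝ≥0∞)

/-! ### Domains -/

/-- The open unit cube `(0,1)^d`. -/
def openCube (d : ℕ) : Set (E d) := {x | ∀ i, x i ∈ Ioo (0 : ℝ) 1}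

/-- The radius `inf_x sup_{y ∈ D} ‖y - x‖₂`, infinite for unbounded sets. -/
def rad {d : ℕ} (D : Set (E d)) : ℝ≥0∞ := ⨅ x : E d, ⨆ y ∈ D, edist y x

/-- Open convex sets of volume one with small radius:
`limsup rad(D_d)/√d < √(2/(π e))`. -/
structure ConvexSmallRadius (D : ∀ d : ℕ, Set (E d)) : Prop where
  isOpen : ∀ d, 1 ≤ d → IsOpen (D d)
  convex : ∀ d, 1 ≤ d → Convex ℝ (D d)
  volume_eq_one : ∀ d, 1 ≤ d → volume (D d) = 1
  limsup_rad_lt :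
    limsup (fun d : ℕ => rad (D d) / ENNReal.ofReal (Real.sqrt d)) atTop
      < ENNReal.ofReal (Real.sqrt (2 / (Real.pi * Real.exp 1)))

/-! ### Function classes -/

/-- The partial derivative `∂^j f / ∂x_{i₁} ⋯ ∂x_{i_j}` at `x`, for `i : Fin j → Fin d`. Where `f`
is `j` times continuously differentiable the order of the indices is irrelevant, and these are
exactly the derivatives `D^β f` with `|β| = j`, `β_m` being the number of indices equal to `m`. -/
def partialDeriv {d : ℕ} (j : ℕ) (i : Fin j → Fin d) (f : E d → ℝ) (x : E d) : ℝ :=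
  iteratedFDeriv ℝ j f x (fun m => EuclideanSpace.single (i m) (1 : ℝ))

/-- The class of `f ∈ C^k(D)` with `‖f‖_∞ ≤ 1` on `D` and `Lip(D^β f) ≤ L_j` on `D` for all
multi-indices with `|β| = j` and all `j ≤ k`. Functions are defined on the whole space, but only
their values on the open set `D` matter, here and for the algorithms and integrals above. -/
def partialClass {d : ℕ} (D : Set (E d)) (k : ℕ) (L : ℕ → ℝ) : Set (E d → ℝ) :=
  {f | ContDiffOn ℝ k f D ∧ (∀ x ∈ D, |f x| ≤ 1) ∧
    ∀ j ≤ k, ∀ i : Fin j → Fin d, ∀ x ∈ D, ∀ y ∈ D,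
      |partialDeriv j i f x - partialDeriv j i f y| ≤ L j * ‖x - y‖}

end CurseIntegration

end

/-! Lower bound. An algorithm that reads only zeros at n points cannot tell F from -F when F
vanishes there, so it suffices to find such an F in the class with integral bounded below. Let K be
the convex hull of the points. By Thales, K is covered by the balls with diameters [x,z], x running
over the points and z being any fixed point (`convexHull_subset_iUnion_closedBall`). With z a centre
of D, a Gaussian Chernoff estimate shows that each ball, even enlarged by a small multiple of √d,
meets D in volume at most q^d with q < 1 (`HullBound`). Hence, unless n is exponential in d, half of
D lies at distance of order √d from K.

The squared distance to a convex set, divided by d, is of order 1 near D, has Lipschitz constant of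
order 1/√d there, and its gradient has Lipschitz constant 2/d. Convolution with a product kernel at
scale √d makes it smooth, and each further partial derivative costs only a dimension-free factor,
because undifferentiated coordinates contribute a factor 1 to the L¹ norm of the kernel
(`exists_mollification`, `exists_fooling`).

Upper bound. On D, of diameter O(√d), the degree j Taylor polynomial approximates f up to a constant
times L_j d^(j+1/2). The monomials involved number O(d^j), so by Carathéodory a positive cubature
formula with polynomially many nodes integrates them almost exactly (`infoComplexity_le_of_taylor`).
-/

noncomputable section

namespace CurseIntegration

/-! ### Convex geometry: hulls covered by balls, squared distance functions -/

section Geometry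

variable {V : Type*} [NormedAddCommGroup V] [InnerProductSpace ℝ V]

/-- If y lies outside every ball with diameter [x,z], the angle at y is acute for each x in s. Then
s, and so its hull, lies in an open half-space with normal y - z that has y on its boundary. -/
theorem convexHull_subset_iUnion_closedBall (s : Set V) (z : V) :
    convexHull ℝ s ⊆ ⋃ x ∈ s, Metric.closedBall ((1 / 2 : ℝ) • (x + z)) (‖x - z‖ / 2) := by
  intro y hy
  by_contra hcon
  have hs : s ⊆ {x | inner ℝ (y - z) x < inner ℝ (y - z) y} := by
    intro x hx
    simp only [mem_iUnion, Metric.mem_closedBall, not_exists, not_le] at hcon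
    have h := hcon x hx
    rw [dist_eq_norm] at h
    have h2 : (‖x - z‖ / 2) ^ 2 < ‖y - (1 / 2 : ℝ) • (x + z)‖ ^ 2 :=
      pow_lt_pow_left₀ h (by positivity) two_ne_zero
    have e1 : y - (1 / 2 : ℝ) • (x + z) = (1 / 2 : ℝ) • ((y - x) + (y - z)) := by
      module
    have e2 : x - z = (y - z) - (y - x) := by abel
    rw [e1, e2, norm_smul, mul_pow, div_pow, norm_add_sq_real, norm_sub_sq_real,
      real_inner_comm (y - z) (y - x)] at h2
    norm_num at h2
    have h3 : 0 < inner ℝ (y - z) (y - x) := by linarith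
    rw [inner_sub_right] at h3
    simp only [mem_ofPred_eq]
    linarith
  have hconv : Convex ℝ {x : V | inner ℝ (y - z) x < inner ℝ (y - z) y} :=
    convex_halfSpace_lt (innerSL ℝ (y - z)).toLinearMap.isLinear _
  exact lt_irrefl (inner ℝ (y - z) y) (convexHull_min hs hconv hy)

theorem exists_metricProjection [ProperSpace V] {K : Set V} (hK : IsClosed K) (hc : Convex ℝ K)
    (hne : K.Nonempty) :
    ∃ P : V → V, ∀ x, P x ∈ K ∧ Metric.infDist x K = ‖x - P x‖ ∧
      ∀ w ∈ K, inner ℝ (x - P x) (w - P x) ≤ 0 := by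
  have h : ∀ x, ∃ y ∈ K, Metric.infDist x K = ‖x - y‖ ∧
      ∀ w ∈ K, inner ℝ (x - y) (w - y) ≤ 0 := by
    intro x
    obtain ⟨y, hy, hxy⟩ := hK.exists_infDist_eq_dist hne x
    rw [dist_eq_norm] at hxy
    refine ⟨y, hy, hxy, (norm_eq_iInf_iff_real_inner_le_zero hc hy).1 ?_⟩
    rw [← hxy, Metric.infDist_eq_iInf]
    simp_rw [dist_eq_norm]
  choose P h1 h2 h3 using h
  exact ⟨P, fun x => ⟨h1 x, h2 x, h3 x⟩⟩

/-- The map G is the residual x - P x of the metric projection, which is firmly nonexpansive. Using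
P a as a competitor for the distance at b gives a quadratic upper bound. Applied in both directions,
together with monotonicity of G, it bounds the remainder of first order by ‖h‖². -/
theorem exists_hasFDerivAt_infDist_sq [ProperSpace V] {K : Set V} (hK : IsClosed K)
    (hc : Convex ℝ K) (hne : K.Nonempty) :
    ∃ G : V → V, (∀ x y, ‖G x - G y‖ ≤ ‖x - y‖) ∧
      ∀ x, HasFDerivAt (fun x => Metric.infDist x K ^ 2) ((2 : ℝ) • innerSL ℝ (G x)) x := by
  obtain ⟨P, hP⟩ := exists_metricProjection hK hc hne
  have key : ∀ x y, ‖(x - P x) - (y - P y)‖ ^ 2 ≤ inner ℝ (x - y) ((x - P x) - (y - P y)) := by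
    intro x y
    have h1 := (hP x).2.2 _ (hP y).1
    have h2 := (hP y).2.2 _ (hP x).1
    have e : x - y = ((x - P x) - (y - P y)) + (P x - P y) := by abel
    have e3 : inner ℝ (P x - P y) ((x - P x) - (y - P y)) =
        - inner ℝ (x - P x) (P y - P x) - inner ℝ (y - P y) (P x - P y) := by
      rw [inner_sub_right, real_inner_comm, real_inner_comm (y - P y), ← neg_sub (P y) (P x),
        inner_neg_right, inner_neg_right]
    conv_rhs => rw [e]
    rw [inner_add_left, real_inner_self_eq_norm_sq, e3]
    linarith
  refine ⟨fun x => x - P x, fun x y => ?_, fun x => ?_⟩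
  · have h := key x y
    have h2 := real_inner_le_norm (x - y) ((x - P x) - (y - P y))
    rcases (norm_nonneg ((x - P x) - (y - P y))).eq_or_lt with h0 | h0
    · rw [← h0]; positivity
    · nlinarith
  · have hup : ∀ a b, Metric.infDist b K ^ 2 ≤
        Metric.infDist a K ^ 2 + 2 * inner ℝ (a - P a) (b - a) + ‖b - a‖ ^ 2 := by
      intro a b
      have h1 : Metric.infDist b K ≤ ‖b - P a‖ := by
        rw [← dist_eq_norm]; exact Metric.infDist_le_dist_of_mem (hP a).1
      have h2 : Metric.infDist b K ^ 2 ≤ ‖b - P a‖ ^ 2 :=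
        pow_le_pow_left₀ Metric.infDist_nonneg h1 2
      have e : b - P a = (a - P a) + (b - a) := by abel
      rw [e, norm_add_sq_real, ← (hP a).2.1] at h2
      exact h2
    rw [hasFDerivAt_iff_isLittleO_nhds_zero]
    refine (Asymptotics.IsBigO.of_bound 1 (Eventually.of_forall fun h => ?_)).trans_isLittleO
      ((Asymptotics.isLittleO_norm_pow_id one_lt_two))
    have u1 := hup x (x + h)
    have u2 := hup (x + h) x
    have u3 := key (x + h) x
    have e1 : x + h - x = h := by abel
    have e2 : x - (x + h) = -h := by abel
    rw [e1] at u1 u3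
    rw [e2, inner_neg_right, norm_neg] at u2
    rw [inner_sub_right, real_inner_comm, real_inner_comm (x - P x)] at u3
    have u4 := sq_nonneg ‖(x + h - P (x + h)) - (x - P x)‖
    simp only [smul_apply, innerSL_apply_apply, smul_eq_mul, Real.norm_eq_abs,
      one_mul, abs_pow, abs_norm]
    rw [abs_le]
    constructor <;> linarith

end Geometry

/-! ### Gaussian volume bounds and the two kinds of domains -/

theorem measureReal_closedBall_le_exp_mul_integral {d : ℕ} {μ : Measure (E d)} {s R : ℝ} (hs : 0 ≤ s)
    {c : E d} (hint : Integrable (fun x => Real.exp (-s * ‖x - c‖ ^ 2)) μ) :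
    μ.real (Metric.closedBall c R) ≤
      Real.exp (s * R ^ 2) * ∫ x, Real.exp (-s * ‖x - c‖ ^ 2) ∂μ := by
  have h := mul_meas_ge_le_integral_of_nonneg
    (Eventually.of_forall fun x => (Real.exp_pos (-s * ‖x - c‖ ^ 2)).le) hint
    (Real.exp (-(s * R ^ 2)))
  have hfin : μ {x | Real.exp (-(s * R ^ 2)) ≤ Real.exp (-s * ‖x - c‖ ^ 2)} ≠ ⊤ :=
    (hint.measure_ge_lt_top (Real.exp_pos _)).ne
  have hsub : Metric.closedBall c R ⊆
      {x | Real.exp (-(s * R ^ 2)) ≤ Real.exp (-s * ‖x - c‖ ^ 2)} := by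
    intro x hx
    rw [Metric.mem_closedBall, dist_eq_norm] at hx
    have : ‖x - c‖ ^ 2 ≤ R ^ 2 := pow_le_pow_left₀ (norm_nonneg _) hx 2
    simp only [mem_ofPred_eq, Real.exp_le_exp]
    nlinarith
  have h2 := measureReal_mono hsub hfin
  have h3 : Real.exp (s * R ^ 2) * Real.exp (-(s * R ^ 2)) = 1 := by
    rw [← Real.exp_add]; simp
  calc μ.real (Metric.closedBall c R)
      = Real.exp (s * R ^ 2) * (Real.exp (-(s * R ^ 2)) * μ.real (Metric.closedBall c R)) := by
        rw [← mul_assoc, h3, one_mul]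
    _ ≤ _ := by
        gcongr
        refine le_trans ?_ h
        gcongr

/-- Chernoff bound with the optimal parameter s = 1/(2ρ²), the minimiser of exp(sρ²d)(π/s)^(d/2).
The resulting constant √(2πe) is what produces the threshold √(2/(πe)) on the radius, since the
covering balls have half the radius of D. -/
theorem measureReal_closedBall_mul_sqrt_le {d : ℕ} (c : E d) {ρ : ℝ} (hρ : 0 < ρ) :
    volume.real (Metric.closedBall c (ρ * √d)) ≤ (ρ * √(2 * Real.pi * Real.exp 1)) ^ d := by
  have hs : 0 < 1 / (2 * ρ ^ 2) := by positivity
  have hI : ∫ x : E d, Real.exp (-(1 / (2 * ρ ^ 2)) * ‖x - c‖ ^ 2) =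
      (Real.pi / (1 / (2 * ρ ^ 2))) ^ ((d : ℝ) / 2) := by
    rw [integral_sub_right_eq_self (fun x : E d => Real.exp (-(1 / (2 * ρ ^ 2)) * ‖x‖ ^ 2)) c,
      GaussianFourier.integral_rexp_neg_mul_sq_norm hs, finrank_euclideanSpace_fin]
  have hint : Integrable (fun x : E d => Real.exp (-(1 / (2 * ρ ^ 2)) * ‖x - c‖ ^ 2)) := by
    refine Integrable.of_integral_ne_zero ?_
    rw [hI]
    positivity
  have h := measureReal_closedBall_le_exp_mul_integral (R := ρ * √d) hs.le hint
  refine h.trans (le_of_eq ?_)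
  rw [hI, mul_pow, Real.sq_sqrt (Nat.cast_nonneg d)]
  have e1 : 1 / (2 * ρ ^ 2) * (ρ ^ 2 * (d : ℝ)) = (1 / 2 : ℝ) * d := by field_simp
  have e2 : Real.pi / (1 / (2 * ρ ^ 2)) = 2 * Real.pi * ρ ^ 2 := by field_simp
  have e3 : ρ * √(2 * Real.pi * Real.exp 1) = Real.exp (1 / 2) * √(2 * Real.pi * ρ ^ 2) := by
    rw [Real.sqrt_mul (by positivity), Real.sqrt_mul (by positivity) (ρ ^ 2),
      Real.sqrt_sq hρ.le, Real.exp_half]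
    ring
  rw [e1, e2, e3, mul_pow, ← Real.exp_nat_mul, mul_comm (d : ℝ) (1 / 2), Real.sqrt_eq_rpow,
    ← Real.rpow_mul_natCast (by positivity)]
  congr 2
  ring

/-- The total exponent t satisfies |t| ≤ 1/12, so exp t ≤ 1 + t + 1/144. The mean of t is -1/72,
minus one sixth of the variance of the uniform law, for every c. -/
theorem exp_mul_setIntegral_gaussian_le {c : ℝ} (hc : |c - 1 / 2| ≤ 1 / 4) :
    Real.exp (1 / 6 * (c - 1 / 2) ^ 2) * ∫ y in Ioo (0 : ℝ) 1, Real.exp (-(1 / 6) * (y - c) ^ 2) ≤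
      143 / 144 := by
  rw [← integral_const_mul]
  have hle : ∀ y ∈ Ioo (0 : ℝ) 1, Real.exp (1 / 6 * (c - 1 / 2) ^ 2) *
      Real.exp (-(1 / 6) * (y - c) ^ 2) ≤
        (-(1 / 6) * y ^ 2 + (1 / 3 * c) * y + (1 + 1 / 24 - c / 6 + 1 / 144)) := by
    intro y hy
    rw [← Real.exp_add]
    set t := 1 / 6 * (c - 1 / 2) ^ 2 + -(1 / 6) * (y - c) ^ 2 with ht
    rw [abs_le] at hc
    have hy1 := hy.1
    have hy2 := hy.2
    have hfac : t = 1 / 6 * ((y - 1 / 2) * (2 * (c - 1 / 2) - (y - 1 / 2))) := by rw [ht]; ring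
    have hb : |t| ≤ 1 / 12 := by
      rw [hfac, abs_mul, abs_mul]
      have h1 : |y - 1 / 2| ≤ 1 / 2 := by rw [abs_le]; constructor <;> linarith
      have h2 : |2 * (c - 1 / 2) - (y - 1 / 2)| ≤ 1 := by rw [abs_le]; constructor <;> linarith
      have := mul_le_mul h1 h2 (abs_nonneg _) (by norm_num)
      rw [abs_of_pos (by norm_num : (0 : ℝ) < 1 / 6)]
      linarith
    have h3 := Real.abs_exp_sub_one_sub_id_le (hb.trans (by norm_num))
    have h4 : t ^ 2 ≤ 1 / 144 := by
      rw [← sq_abs]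
      nlinarith [abs_nonneg t]
    have h5 := (abs_le.1 h3).2
    rw [ht] at h5 h4 ⊢
    nlinarith
  have hc1 : IntegrableOn (fun y : ℝ => Real.exp (1 / 6 * (c - 1 / 2) ^ 2) *
      Real.exp (-(1 / 6) * (y - c) ^ 2)) (Ioo 0 1) :=
    (Continuous.integrableOn_Icc (by fun_prop)).mono_set Ioo_subset_Icc_self
  have hc2 : IntegrableOn (fun y : ℝ =>
      (-(1 / 6) * y ^ 2 + (1 / 3 * c) * y + (1 + 1 / 24 - c / 6 + 1 / 144))) (Ioo 0 1) :=
    (Continuous.integrableOn_Icc (by fun_prop)).mono_set Ioo_subset_Icc_self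
  refine (setIntegral_mono_on hc1 hc2 measurableSet_Ioo hle).trans (le_of_eq ?_)
  rw [← integral_Ioc_eq_integral_Ioo, ← intervalIntegral.integral_of_le zero_le_one,
    intervalIntegral.integral_add, intervalIntegral.integral_add,
    intervalIntegral.integral_const_mul, intervalIntegral.integral_const_mul, integral_pow,
    integral_id, intervalIntegral.integral_const]
  · norm_num
    ring
  all_goals exact Continuous.intervalIntegrable (by fun_prop) _ _

theorem openCube_eq_preimage (d : ℕ) :
    openCube d = WithLp.ofLp ⁻¹' (univ.pi fun _ : Fin d => Ioo (0 : ℝ) 1) := by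
  ext x
  simp [openCube, Set.mem_pi]

theorem measurePreserving_ofLp_openCube (d : ℕ) :
    MeasurePreserving (WithLp.ofLp : E d → Fin d → ℝ) (volume.restrict (openCube d))
      (Measure.pi fun _ : Fin d => (volume.restrict (Ioo (0 : ℝ) 1))) := by
  have h := (EuclideanSpace.volume_preserving_symm_measurableEquiv_toLp (Fin d)).restrict_preimage
    (s := univ.pi fun _ : Fin d => Ioo (0 : ℝ) 1) (MeasurableSet.univ_pi fun _ => measurableSet_Ioo)
  rw [volume_pi, Measure.restrict_pi_pi] at h
  rw [openCube_eq_preimage]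
  exact h

theorem integral_openCube_prod {d : ℕ} (f : Fin d → ℝ → ℝ) :
    ∫ x in openCube d, ∏ i, f i (x i) = ∏ i, ∫ y in Ioo (0 : ℝ) 1, f i y := by
  rw [← integral_fintype_prod_eq_prod,
    ← (measurePreserving_ofLp_openCube d).integral_comp (MeasurableEquiv.toLp 2 (Fin d → ℝ)).symm.measurableEmbedding]

theorem volume_openCube (d : ℕ) : volume (openCube d) = 1 := by
  have h := (measurePreserving_ofLp_openCube d).measure_preimage MeasurableSet.univ.nullMeasurableSet
  simpa [Measure.pi_univ] using h

theorem isOpen_openCube (d : ℕ) : IsOpen (openCube d) := by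
  rw [openCube_eq_preimage]
  exact (isOpen_set_pi finite_univ fun _ _ => isOpen_Ioo).preimage (PiLp.continuous_ofLp 2 _)

theorem convex_openCube (d : ℕ) : Convex ℝ (openCube d) := by
  intro x hx y hy a b ha hb hab i
  exact (convex_Ioo (0 : ℝ) 1) (hx i) (hy i) ha hb hab

/-- The cube has radius √d/2, slightly above the threshold for small radius, so the volume of the
whole ball is too crude a bound. The Chernoff estimate is applied to Lebesgue measure on the cube
instead, where it factorises over the coordinates. -/
theorem measureReal_openCube_inter_closedBall_le {d : ℕ} {ε : ℝ} (hε : 0 ≤ ε) {c z : E d}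
    (hz : ∀ i, z i = 1 / 2) (hc : ∀ i, |c i - 1 / 2| ≤ 1 / 4) :
    volume.real (openCube d ∩ Metric.closedBall c (‖c - z‖ + ε * √d)) ≤
      (Real.exp (1 / 6 * (ε / 2 + ε ^ 2)) * (143 / 144)) ^ d := by
  have hnorm : ∀ x : E d, ‖x‖ ^ 2 = ∑ i, x i ^ 2 := fun x => by
    rw [EuclideanSpace.norm_sq_eq]; simp
  have hprod : ∀ x : E d, Real.exp (-(1 / 6) * ‖x - c‖ ^ 2) =
      ∏ i, Real.exp (-(1 / 6) * (x i - c i) ^ 2) := by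
    intro x
    rw [hnorm, Finset.mul_sum, Real.exp_sum]
    rfl
  have : IsFiniteMeasure (volume.restrict (openCube d)) :=
    ⟨by rw [Measure.restrict_apply_univ, volume_openCube]; exact ENNReal.one_lt_top⟩
  have hint : Integrable (fun x : E d => Real.exp (-(1 / 6) * ‖x - c‖ ^ 2))
      (volume.restrict (openCube d)) := by
    refine Integrable.of_bound (C := 1) (by fun_prop) (Eventually.of_forall fun x => ?_)
    rw [Real.norm_eq_abs, Real.abs_exp, Real.exp_le_one_iff]
    have := sq_nonneg ‖x - c‖
    linarith
  have h := measureReal_closedBall_le_exp_mul_integral (R := ‖c - z‖ + ε * √d)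
    (by norm_num : (0 : ℝ) ≤ 1 / 6) hint
  rw [measureReal_restrict_apply Metric.isClosed_closedBall.measurableSet, inter_comm] at h
  refine h.trans ?_
  simp_rw [hprod]
  rw [integral_openCube_prod (fun i y => Real.exp (-(1 / 6) * (y - c i) ^ 2))]
  have hcz : ‖c - z‖ ^ 2 = ∑ i, (c i - 1 / 2) ^ 2 := by
    rw [hnorm]
    exact Finset.sum_congr rfl fun i _ => by rw [← hz i]; rfl
  have hd : √(d : ℝ) ^ 2 = d := Real.sq_sqrt (Nat.cast_nonneg d)
  have hcz2 : ‖c - z‖ ≤ 1 / 4 * √d := by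
    refine abs_le_of_sq_le_sq' ?_ (by positivity) |>.2
    rw [mul_pow, hd, hcz]
    refine (Finset.sum_le_card_nsmul _ _ ((1 / 4 : ℝ) ^ 2) fun i _ => ?_).trans (le_of_eq ?_)
    · rw [← sq_abs]; exact pow_le_pow_left₀ (abs_nonneg _) (hc i) 2
    · simp [mul_comm]
  -- The cross term 2ε√d‖c - z‖ is at most εd/2, which makes the bound a sum over coordinates.
  have hR : (‖c - z‖ + ε * √d) ^ 2 ≤ ∑ i, ((c i - 1 / 2) ^ 2 + (ε / 2 + ε ^ 2)) := by
    rw [Finset.sum_add_distrib, ← hcz]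
    simp only [Finset.sum_const, Finset.card_univ, Fintype.card_fin, nsmul_eq_mul]
    have : ‖c - z‖ * √d ≤ 1 / 4 * d := by
      nlinarith [mul_le_mul_of_nonneg_right hcz2 (Real.sqrt_nonneg d)]
    nlinarith
  calc Real.exp (1 / 6 * (‖c - z‖ + ε * √d) ^ 2) *
        ∏ i, ∫ y in Ioo (0 : ℝ) 1, Real.exp (-(1 / 6) * (y - c i) ^ 2)
      ≤ Real.exp (1 / 6 * ∑ i, ((c i - 1 / 2) ^ 2 + (ε / 2 + ε ^ 2))) *
        ∏ i, ∫ y in Ioo (0 : ℝ) 1, Real.exp (-(1 / 6) * (y - c i) ^ 2) := by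
        gcongr
    _ = ∏ i, (Real.exp (1 / 6 * (ε / 2 + ε ^ 2)) * (Real.exp (1 / 6 * (c i - 1 / 2) ^ 2) *
          ∫ y in Ioo (0 : ℝ) 1, Real.exp (-(1 / 6) * (y - c i) ^ 2))) := by
        rw [Finset.mul_sum, Real.exp_sum, ← Finset.prod_mul_distrib]
        refine Finset.prod_congr rfl fun i _ => ?_
        rw [mul_add, Real.exp_add]
        ring
    _ ≤ ∏ i : Fin d, (Real.exp (1 / 6 * (ε / 2 + ε ^ 2)) * (143 / 144)) := by
        refine Finset.prod_le_prod (fun i _ => ?_) fun i _ => ?_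
        · have : 0 ≤ ∫ y in Ioo (0 : ℝ) 1, Real.exp (-(1 / 6) * (y - c i) ^ 2) :=
            integral_nonneg fun y => (Real.exp_pos _).le
          positivity
        · gcongr
          exact exp_mul_setIntegral_gaussian_le (hc i)
    _ = _ := by simp

/-- Neighbourhoods of convex hulls of few points of `D` have small volume in `D`. -/
def HullBound {d : ℕ} (D : Set (E d)) (ε q : ℝ) : Prop :=
  ∀ s : Finset (E d), (s : Set (E d)) ⊆ D → s.Nonempty →
    volume.real (D ∩ {x | Metric.infDist x (convexHull ℝ (s : Set (E d))) ≤ ε * √d}) ≤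
      s.card * q ^ d

theorem infDist_convexHull_le_subset {d : ℕ} {s : Finset (E d)} (hs : s.Nonempty) (z : E d)
    (δ : ℝ) :
    {x | Metric.infDist x (convexHull ℝ (s : Set (E d))) ≤ δ} ⊆
      ⋃ x ∈ s, Metric.closedBall ((1 / 2 : ℝ) • (x + z)) (‖x - z‖ / 2 + δ) := by
  intro x hx
  obtain ⟨y, hy, hxy⟩ := (s.finite_toSet.isCompact_convexHull ℝ).exists_infDist_eq_dist
    ((convexHull_nonempty_iff (𝕜 := ℝ)).2 hs.to_set) x
  have := convexHull_subset_iUnion_closedBall (s : Set (E d)) z hy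
  simp only [mem_iUnion, Finset.mem_coe] at this ⊢
  obtain ⟨p, hp, hyp⟩ := this
  refine ⟨p, hp, ?_⟩
  rw [Metric.mem_closedBall] at hyp ⊢
  have hx' : dist x y ≤ δ := hxy ▸ hx
  linarith [dist_triangle x y ((1 / 2 : ℝ) • (p + z))]

theorem hullBound_of_closedBall {d : ℕ} {D : Set (E d)} {ε q : ℝ} {z : E d}
    (h : ∀ x ∈ D, volume.real (D ∩ Metric.closedBall ((1 / 2 : ℝ) • (x + z))
      (‖x - z‖ / 2 + ε * √d)) ≤ q ^ d) : HullBound D ε q := by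
  intro s hs hne
  have hsub : D ∩ {x | Metric.infDist x (convexHull ℝ (s : Set (E d))) ≤ ε * √d} ⊆
      ⋃ x ∈ s, D ∩ Metric.closedBall ((1 / 2 : ℝ) • (x + z)) (‖x - z‖ / 2 + ε * √d) := by
    rw [← inter_iUnion₂]
    exact inter_subset_inter_right _ (infDist_convexHull_le_subset hne z _)
  calc volume.real _ ≤ volume.real (⋃ x ∈ s, D ∩ Metric.closedBall ((1 / 2 : ℝ) • (x + z))
        (‖x - z‖ / 2 + ε * √d)) := by
        refine measureReal_mono hsub (ne_top_of_le_ne_top ?_ (measure_biUnion_finset_le _ _))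
        refine (ENNReal.sum_lt_top.2 fun x _ => ?_).ne
        exact (measure_mono inter_subset_right).trans_lt measure_closedBall_lt_top
    _ ≤ ∑ x ∈ s, volume.real (D ∩ Metric.closedBall ((1 / 2 : ℝ) • (x + z))
        (‖x - z‖ / 2 + ε * √d)) := measureReal_biUnion_finset_le _ _
    _ ≤ ∑ x ∈ s, q ^ d := Finset.sum_le_sum fun x hx => h x (hs hx)
    _ = s.card * q ^ d := by simp

theorem hullBound_of_subset_closedBall {d : ℕ} {D : Set (E d)} {ε r : ℝ} {z : E d} (hε : 0 < ε)
    (hr : 0 ≤ r) (hD : D ⊆ Metric.closedBall z (r * √d)) :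
    HullBound D ε ((r / 2 + ε) * √(2 * Real.pi * Real.exp 1)) := by
  refine hullBound_of_closedBall (z := z) fun x hx => ?_
  refine le_trans (measureReal_mono ?_ measure_closedBall_lt_top.ne)
    (measureReal_closedBall_mul_sqrt_le ((1 / 2 : ℝ) • (x + z)) (by positivity : 0 < r / 2 + ε))
  refine inter_subset_right.trans (Metric.closedBall_subset_closedBall ?_)
  have := hD hx
  rw [Metric.mem_closedBall, dist_eq_norm] at this
  nlinarith

/-- The common properties of the domains in both cases. -/
structure AdmissibleDomain {d : ℕ} (D : Set (E d)) (ε q : ℝ) : Prop where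
  isOpen : IsOpen D
  convex : Convex ℝ D
  volume_eq_one : volume D = 1
  exists_subset_closedBall : ∃ z, D ⊆ Metric.closedBall z √d
  hullBound : HullBound D ε q

theorem admissibleDomain_openCube (d : ℕ) :
    AdmissibleDomain (openCube d) (1 / 100)
      (Real.exp (1 / 6 * ((1 / 100) / 2 + (1 / 100) ^ 2)) * (143 / 144)) := by
  set z : E d := WithLp.toLp 2 fun _ => 1 / 2 with hz
  refine ⟨isOpen_openCube d, convex_openCube d, volume_openCube d, ⟨z, fun x hx => ?_⟩, ?_⟩
  · rw [Metric.mem_closedBall, EuclideanSpace.dist_eq]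
    refine Real.sqrt_le_sqrt ?_
    refine (Finset.sum_le_card_nsmul _ _ 1 fun i _ => ?_).trans (by simp)
    have h := hx i
    have : |x i - 1 / 2| ≤ 1 := by
      rw [abs_le]; constructor <;> linarith [h.1, h.2]
    rw [Real.dist_eq]
    exact pow_le_one₀ (abs_nonneg _) this
  · refine hullBound_of_closedBall (z := z) fun x hx => ?_
    have e : ‖x - z‖ / 2 = ‖(1 / 2 : ℝ) • (x + z) - z‖ := by
      have : (1 / 2 : ℝ) • (x + z) - z = (1 / 2 : ℝ) • (x - z) := by module
      rw [this, norm_smul]; norm_num; ring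
    rw [e]
    refine measureReal_openCube_inter_closedBall_le (by norm_num) (fun i => rfl) fun i => ?_
    have h := hx i
    have e2 : ((1 / 2 : ℝ) • (x + z)) i = 1 / 2 * (x i + 1 / 2) := rfl
    rw [e2, abs_le]
    constructor <;> linarith [h.1, h.2]

theorem exists_subset_closedBall_of_rad_lt {d : ℕ} {D : Set (E d)} {r : ℝ} (hr : 0 ≤ r)
    (h : rad D < ENNReal.ofReal r) : ∃ z, D ⊆ Metric.closedBall z r := by
  obtain ⟨z, hz⟩ := iInf_lt_iff.1 h
  refine ⟨z, fun y hy => ?_⟩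
  have h1 : edist y z ≤ ENNReal.ofReal r := (le_iSup₂ (f := fun y _ => edist y z) y hy).trans hz.le
  rw [edist_dist] at h1
  exact (ENNReal.ofReal_le_ofReal_iff hr).1 h1

theorem sqrt_two_div_pi_exp_mul :
    √(2 / (Real.pi * Real.exp 1)) * √(2 * Real.pi * Real.exp 1) = 2 := by
  rw [← Real.sqrt_mul (by positivity)]
  have : 2 / (Real.pi * Real.exp 1) * (2 * Real.pi * Real.exp 1) = 2 ^ 2 := by
    field_simp
  rw [this, Real.sqrt_sq (by norm_num)]

theorem exists_admissibleDomain (D : ∀ d : ℕ, Set (E d))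
    (hD : (∀ d, 1 ≤ d → D d = openCube d) ∨ ConvexSmallRadius D) :
    ∃ ε q : ℝ, 0 < ε ∧ 0 < q ∧ q < 1 ∧ ∀ᶠ d in atTop, AdmissibleDomain (D d) ε q := by
  rcases hD with hD | hD
  · refine ⟨1 / 100, Real.exp (1 / 6 * ((1 / 100) / 2 + (1 / 100) ^ 2)) * (143 / 144),
      by norm_num, by positivity, ?_, ?_⟩
    rotate_left
    · filter_upwards [eventually_ge_atTop 1] with d hd
      rw [hD d hd]
      exact admissibleDomain_openCube d
    · have h := Real.exp_bound_div_one_sub_of_interval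
        (x := 1 / 6 * ((1 / 100) / 2 + (1 / 100) ^ 2)) (by norm_num) (by norm_num)
      have h2 : (1 : ℝ) / (1 - 1 / 6 * ((1 / 100) / 2 + (1 / 100) ^ 2)) < 1001 / 1000 := by norm_num
      linarith
  · obtain ⟨a, ha1, ha2⟩ := exists_between hD.limsup_rad_lt
    have hat : a ≠ ⊤ := (ha2.trans ENNReal.ofReal_lt_top).ne
    set r := a.toReal with hr
    have hr0 : 0 ≤ r := ENNReal.toReal_nonneg
    have har : a = ENNReal.ofReal r := (ENNReal.ofReal_toReal hat).symm
    set B := √(2 * Real.pi * Real.exp 1) with hB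
    have hB0 : 0 < B := by positivity
    have hrlt : r < √(2 / (Real.pi * Real.exp 1)) := by
      rw [har] at ha2
      exact (ENNReal.ofReal_lt_ofReal_iff_of_nonneg hr0).1 ha2
    have hrB : r * B < 2 := by
      rw [← sqrt_two_div_pi_exp_mul]
      exact mul_lt_mul_of_pos_right hrlt hB0
    have hr1 : r ≤ 1 := by
      refine hrlt.le.trans (Real.sqrt_le_one.2 ?_)
      rw [div_le_one (by positivity)]
      nlinarith [Real.pi_gt_three, Real.add_one_le_exp (1 : ℝ)]
    -- This width makes q = (r/2 + ε)B the midpoint of rB/2 and 1.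
    have hε : 0 < (1 - r * B / 2) / (2 * B) := div_pos (by linarith) (by positivity)
    refine ⟨(1 - r * B / 2) / (2 * B), (r / 2 + (1 - r * B / 2) / (2 * B)) * B, hε,
      by positivity, ?_, ?_⟩
    · have : (r / 2 + (1 - r * B / 2) / (2 * B)) * B = (r * B / 2 + 1) / 2 := by
        field_simp; ring
      rw [this]; linarith
    · filter_upwards [eventually_ge_atTop 1, eventually_lt_of_limsup_lt ha1] with d hd had
      have hdpos : 0 < √(d : ℝ) := Real.sqrt_pos.2 (by exact_mod_cast hd)
      have hlt : rad (D d) < ENNReal.ofReal (r * √d) := by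
        rw [ENNReal.div_lt_iff (by simp [hdpos]) (by simp), har, ← ENNReal.ofReal_mul hr0] at had
        exact had
      obtain ⟨z, hz⟩ := exists_subset_closedBall_of_rad_lt (by positivity) hlt
      exact ⟨hD.isOpen d hd, hD.convex d hd, hD.volume_eq_one d hd,
        ⟨z, hz.trans (Metric.closedBall_subset_closedBall (by nlinarith))⟩,
        hullBound_of_subset_closedBall hε hr0 hz⟩

/-! ### Mollification by product kernels -/

open scoped ContDiff Convolution

theorem exists_smooth_bump (k : ℕ) {ε : ℝ} (hε : 0 < ε) :
    ∃ ρ : ℝ → ℝ, ContDiff ℝ ∞ ρ ∧ (∀ x, 0 ≤ ρ x) ∧ ∫ x, ρ x = 1 ∧ tsupport ρ ⊆ Icc (-ε) ε ∧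
      ∃ M : ℝ, 1 ≤ M ∧ ∀ m ≤ k, ∫ x, |iteratedDeriv m ρ x| ≤ M := by
  let b : ContDiffBump (0 : ℝ) := ⟨ε / 2, ε, by positivity, by linarith⟩
  refine ⟨b.normed volume, b.contDiff_normed, b.nonneg_normed, b.integral_normed, ?_,
    1 + ∑ m ∈ Finset.range (k + 1), ∫ x, |iteratedDeriv m (b.normed volume) x|, ?_, ?_⟩
  · rw [b.tsupport_normed_eq, Real.closedBall_eq_Icc]
    simp [b]
  · have : 0 ≤ ∑ m ∈ Finset.range (k + 1), ∫ x, |iteratedDeriv m (b.normed volume) x| :=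
      Finset.sum_nonneg fun m _ => integral_nonneg fun x => abs_nonneg _
    linarith
  · intro m hm
    have := Finset.single_le_sum (f := fun m => ∫ x, |iteratedDeriv m (b.normed volume) x|)
      (fun m _ => integral_nonneg fun x => abs_nonneg _) (Finset.mem_range.2 (Nat.lt_succ_of_le hm))
    linarith

/-- The product kernel built from derivatives of a function of one variable. -/
def productKernel (ρ : ℝ → ℝ) {d : ℕ} (n : Fin d → ℕ) (x : E d) : ℝ :=
  ∏ l, iteratedDeriv (n l) ρ (x l)

section Kernel

variable {ρ : ℝ → ℝ} {d : ℕ} {ε : ℝ}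

theorem contDiff_iteratedDeriv_of_contDiff_infty (hρ : ContDiff ℝ ∞ ρ) (m : ℕ) :
    ContDiff ℝ ∞ (iteratedDeriv m ρ) := by
  induction m with
  | zero => simpa using hρ
  | succ m ih =>
    rw [iteratedDeriv_succ]
    exact (contDiff_infty_iff_deriv.1 ih).2

theorem contDiff_productKernel (hρ : ContDiff ℝ ∞ ρ) (n : Fin d → ℕ) :
    ContDiff ℝ ∞ (productKernel ρ n) := by
  unfold productKernel
  refine contDiff_prod fun l _ => ?_
  refine (contDiff_iteratedDeriv_of_contDiff_infty hρ (n l)).comp ?_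
  fun_prop

theorem tsupport_iteratedDeriv_subset (m : ℕ) : tsupport (iteratedDeriv m ρ) ⊆ tsupport ρ := by
  induction m with
  | zero => simp
  | succ m ih =>
    rw [iteratedDeriv_succ]
    exact (closure_minimal support_deriv_subset (isClosed_tsupport _)).trans ih

theorem productKernel_eq_zero (hε : 0 ≤ ε) (hs : tsupport ρ ⊆ Icc (-ε) ε) (n : Fin d → ℕ) {x : E d}
    (hx : ε * √d < ‖x‖) : productKernel ρ n x = 0 := by
  by_contra h
  rw [productKernel, Finset.prod_eq_zero_iff] at h
  push Not at h
  have hle : ∀ l, x l ^ 2 ≤ ε ^ 2 := by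
    intro l
    have := hs (tsupport_iteratedDeriv_subset _ (subset_tsupport _ (h l (Finset.mem_univ l))))
    exact sq_le_sq' this.1 this.2
  have : ‖x‖ ≤ ε * √d := by
    refine abs_le_of_sq_le_sq' ?_ (by positivity) |>.2
    rw [EuclideanSpace.norm_sq_eq, mul_pow, Real.sq_sqrt (Nat.cast_nonneg d)]
    refine (Finset.sum_le_card_nsmul _ _ (ε ^ 2) fun l _ => ?_).trans ?_
    · simpa using hle l
    · simp [mul_comm]
  linarith

theorem hasCompactSupport_productKernel (hε : 0 ≤ ε) (hs : tsupport ρ ⊆ Icc (-ε) ε)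
    (n : Fin d → ℕ) : HasCompactSupport (productKernel ρ n) := by
  refine HasCompactSupport.intro (isCompact_closedBall (0 : E d) (ε * √d)) fun x hx => ?_
  refine productKernel_eq_zero hε hs n ?_
  simpa using hx

theorem fderiv_productKernel (hρ : ContDiff ℝ ∞ ρ) (n : Fin d → ℕ) (x : E d) (a : Fin d) :
    fderiv ℝ (productKernel ρ n) x (EuclideanSpace.single a 1) =
      productKernel ρ (n + Pi.single a 1) x := by
  have hd : DifferentiableAt ℝ (productKernel ρ n) x :=
    (contDiff_productKernel hρ n).differentiable (by simp) x
  rw [← hd.lineDeriv_eq_fderiv]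
  refine HasLineDerivAt.lineDeriv ?_
  rw [HasLineDerivAt]
  have e1 : ∀ t : ℝ, productKernel ρ n (x + t • EuclideanSpace.single a 1) =
      iteratedDeriv (n a) ρ (x a + t) *
        ∏ l ∈ Finset.univ.erase a, iteratedDeriv (n l) ρ (x l) := by
    intro t
    rw [productKernel, ← Finset.mul_prod_erase _ _ (Finset.mem_univ a)]
    congr 1
    · simp
    · refine Finset.prod_congr rfl fun l hl => ?_
      have : l ≠ a := Finset.ne_of_mem_erase hl
      simp [this]
  have e2 : productKernel ρ (n + Pi.single a 1) x = deriv (iteratedDeriv (n a) ρ) (x a) *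
        ∏ l ∈ Finset.univ.erase a, iteratedDeriv (n l) ρ (x l) := by
    rw [productKernel, ← Finset.mul_prod_erase _ _ (Finset.mem_univ a)]
    congr 1
    · simp [iteratedDeriv_succ]
    · refine Finset.prod_congr rfl fun l hl => ?_
      have : l ≠ a := Finset.ne_of_mem_erase hl
      simp [this]
  simp_rw [e1]
  rw [e2]
  refine HasDerivAt.mul_const ?_ _
  have h : HasDerivAt (iteratedDeriv (n a) ρ) (deriv (iteratedDeriv (n a) ρ) (x a + 0)) (x a + 0) :=
    ((contDiff_iteratedDeriv_of_contDiff_infty hρ (n a)).differentiable (by simp) _).hasDerivAt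
  simpa using h.comp_const_add (x a) 0

theorem integral_prod_euclidean {d : ℕ} (f : Fin d → ℝ → ℝ) :
    ∫ x : E d, ∏ i, f i (x i) = ∏ i, ∫ y, f i y := by
  rw [← integral_fintype_prod_volume_eq_prod,
    ← (EuclideanSpace.volume_preserving_symm_measurableEquiv_toLp (Fin d)).integral_comp
      (MeasurableEquiv.toLp 2 (Fin d → ℝ)).symm.measurableEmbedding]
  rfl

/-- By Fubini the norm is a product over coordinates. An undifferentiated coordinate contributes
exactly 1 and at most k coordinates are differentiated, so the bound is independent of d. -/
theorem integral_abs_productKernel_le (hρ0 : ∀ x, 0 ≤ ρ x) (hρ1 : ∫ x, ρ x = 1) {k : ℕ} {M : ℝ}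
    (hM : 1 ≤ M) (hρM : ∀ m ≤ k, ∫ x, |iteratedDeriv m ρ x| ≤ M) {n : Fin d → ℕ}
    (hn : ∑ l, n l ≤ k) : ∫ x, |productKernel ρ n x| ≤ M ^ k := by
  simp_rw [productKernel, Finset.abs_prod]
  rw [integral_prod_euclidean fun l y => |iteratedDeriv (n l) ρ y|]
  calc ∏ l, ∫ y, |iteratedDeriv (n l) ρ y| ≤ ∏ l, M ^ n l := by
        refine Finset.prod_le_prod (fun l _ => integral_nonneg fun y => abs_nonneg _) fun l _ => ?_
        rcases Nat.eq_zero_or_pos (n l) with h0 | h0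
        · simp [h0, abs_of_nonneg (hρ0 _), hρ1]
        · refine (hρM _ ?_).trans (le_self_pow₀ hM h0.ne')
          exact (Finset.single_le_sum (fun _ _ => Nat.zero_le _) (Finset.mem_univ l)).trans hn
    _ = M ^ ∑ l, n l := Finset.prod_pow_eq_pow_sum _ _ _
    _ ≤ M ^ k := pow_le_pow_right₀ hM hn

theorem integral_productKernel_zero (hρ1 : ∫ x, ρ x = 1) :
    ∫ x : E d, productKernel ρ 0 x = 1 := by
  simp_rw [productKernel]
  rw [integral_prod_euclidean fun l y => iteratedDeriv ((0 : Fin d → ℕ) l) ρ y]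
  simp [hρ1]

end Kernel

theorem partialDeriv_zero {d : ℕ} (i : Fin 0 → Fin d) (f : E d → ℝ) (x : E d) :
    partialDeriv 0 i f x = f x := by
  simp [partialDeriv]

theorem partialDeriv_succ {d j : ℕ} (i : Fin (j + 1) → Fin d) {f : E d → ℝ}
    (hf : ContDiff ℝ (j + 1) f) (x : E d) :
    partialDeriv (j + 1) i f x = partialDeriv j (Fin.init i)
      (fun y => fderiv ℝ f y (EuclideanSpace.single (i (Fin.last j)) 1)) x := by
  rw [partialDeriv, iteratedFDeriv_succ_apply_right, partialDeriv,
    iteratedFDeriv_clm_apply_const_apply (n := j) (hf.fderiv_right le_rfl) le_rfl]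
  rfl

section Mollification

variable {ρ : ℝ → ℝ} {d : ℕ} {ε : ℝ}

/-- Convolution with a product kernel. -/
def mollify (ρ : ℝ → ℝ) {d : ℕ} (n : Fin d → ℕ) (g : E d → ℝ) (x : E d) : ℝ :=
  ∫ t, g (x - t) * productKernel ρ n t

theorem mollify_eq_convolution (n : Fin d → ℕ) (g : E d → ℝ) :
    mollify ρ n g = g ⋆[ContinuousLinearMap.mul ℝ ℝ, volume] productKernel ρ n := by
  ext x
  rw [convolution_mul_swap, mollify]

theorem contDiff_mollify (hε : 0 ≤ ε) (hs : tsupport ρ ⊆ Icc (-ε) ε) (hρ : ContDiff ℝ ∞ ρ)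
    (n : Fin d → ℕ) {g : E d → ℝ} (hg : Continuous g) : ContDiff ℝ ∞ (mollify ρ n g) := by
  rw [mollify_eq_convolution]
  exact (hasCompactSupport_productKernel hε hs n).contDiff_convolution_right _
    hg.locallyIntegrable (contDiff_productKernel hρ n)

theorem fderiv_mollify (hε : 0 ≤ ε) (hs : tsupport ρ ⊆ Icc (-ε) ε) (hρ : ContDiff ℝ ∞ ρ)
    (n : Fin d → ℕ) {g : E d → ℝ} (hg : Continuous g) (x : E d) (a : Fin d) :
    fderiv ℝ (mollify ρ n g) x (EuclideanSpace.single a 1) =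
      mollify ρ (n + Pi.single a 1) g x := by
  have hc := hasCompactSupport_productKernel (d := d) hε hs n
  have hsm : ContDiff ℝ 1 (productKernel ρ n) := (contDiff_productKernel hρ n).of_le (by simp)
  rw [mollify_eq_convolution, (hc.hasFDerivAt_convolution_right
    (ContinuousLinearMap.mul ℝ ℝ) hg.locallyIntegrable hsm x).fderiv,
    convolution_precompR_apply _ hg.locallyIntegrable (hc.fderiv ℝ)
      (hsm.continuous_fderiv one_ne_zero), mollify_eq_convolution]
  congr 1
  ext y
  exact fderiv_productKernel hρ n y a

theorem partialDeriv_mollify (hε : 0 ≤ ε) (hs : tsupport ρ ⊆ Icc (-ε) ε) (hρ : ContDiff ℝ ∞ ρ)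
    {g : E d → ℝ} (hg : Continuous g) {j : ℕ} (i : Fin j → Fin d) (n : Fin d → ℕ) (x : E d) :
    partialDeriv j i (mollify ρ n g) x = mollify ρ (n + ∑ m, Pi.single (i m) 1) g x := by
  induction j generalizing n with
  | zero => simp [partialDeriv_zero]
  | succ j ih =>
    rw [partialDeriv_succ i ((contDiff_mollify hε hs hρ n hg).of_le (by exact_mod_cast le_top))]
    simp_rw [fderiv_mollify hε hs hρ n hg]
    rw [ih, Fin.sum_univ_castSucc]
    congr 1
    rw [add_assoc, add_comm (Pi.single _ _)]
    rfl

theorem integrable_mul_productKernel (hε : 0 ≤ ε) (hs : tsupport ρ ⊆ Icc (-ε) ε)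
    (hρ : ContDiff ℝ ∞ ρ) (n : Fin d → ℕ) {g : E d → ℝ} (hg : Continuous g) :
    Integrable (fun t => g t * productKernel ρ n t) :=
  (hg.mul (contDiff_productKernel hρ n).continuous).integrable_of_hasCompactSupport
    ((hasCompactSupport_productKernel hε hs n).mul_left)

/-- Integration by parts. As g is only C¹, exactly one derivative is moved onto it, which brings in
the Lipschitz constant of its gradient. -/
theorem mollify_add_single (hε : 0 ≤ ε) (hs : tsupport ρ ⊆ Icc (-ε) ε) (hρ : ContDiff ℝ ∞ ρ)
    (n : Fin d → ℕ) {g : E d → ℝ} (hg : ContDiff ℝ 1 g) (a : Fin d) (x : E d) :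
    mollify ρ (n + Pi.single a 1) g x =
      mollify ρ n (fun y => fderiv ℝ g y (EuclideanSpace.single a 1)) x := by
  have hgc : Continuous (fun y => fderiv ℝ g y (EuclideanSpace.single a 1)) :=
    (hg.continuous_fderiv one_ne_zero).clm_apply continuous_const
  have hfd : ∀ t, fderiv ℝ (fun t => g (x - t)) t (EuclideanSpace.single a 1) =
      - fderiv ℝ g (x - t) (EuclideanSpace.single a 1) := by
    intro t
    have h1 : HasFDerivAt g (fderiv ℝ g (x - t)) (x - t) :=
      (hg.differentiable one_ne_zero _).hasFDerivAt
    have h2 : HasFDerivAt (fun t => g (x - t)) _ t := h1.comp t ((hasFDerivAt_id t).const_sub x)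
    rw [h2.fderiv]
    simp
  have h := integral_mul_fderiv_eq_neg_fderiv_mul_of_integrable (μ := (volume : Measure (E d)))
    (f := fun t => g (x - t)) (g := productKernel ρ n) (v := EuclideanSpace.single a 1)
    (by
      simp_rw [hfd]
      exact integrable_mul_productKernel hε hs hρ n (by fun_prop))
    (by
      simp_rw [fderiv_productKernel hρ]
      exact integrable_mul_productKernel hε hs hρ _ (hg.continuous.comp (by fun_prop)))
    (integrable_mul_productKernel hε hs hρ n (hg.continuous.comp (by fun_prop)))
    (fun t _ => ((hg.differentiable one_ne_zero _).comp t (by fun_prop)))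
    (fun t _ => (contDiff_productKernel hρ n).differentiable (by simp) t)
  simp_rw [fderiv_productKernel hρ, hfd] at h
  rw [mollify, h, mollify, ← integral_neg]
  exact integral_congr_ae (Eventually.of_forall fun t => by simp)

theorem abs_mollify_sub_le (hε : 0 ≤ ε) (hs : tsupport ρ ⊆ Icc (-ε) ε) (hρ : ContDiff ℝ ∞ ρ)
    (n : Fin d → ℕ) {g : E d → ℝ} (hg : Continuous g) {x y : E d} {A : ℝ}
    (h : ∀ t, ‖t‖ ≤ ε * √d → |g (x - t) - g (y - t)| ≤ A) :
    |mollify ρ n g x - mollify ρ n g y| ≤ A * ∫ t, |productKernel ρ n t| := by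
  have hi : ∀ z, Integrable (fun t => g (z - t) * productKernel ρ n t) := fun z =>
    integrable_mul_productKernel hε hs hρ n (hg.comp (by fun_prop))
  have hi2 : Integrable (fun t => |productKernel (d := d) ρ n t|) := by
    simpa using (integrable_mul_productKernel (d := d) hε hs hρ n
      (g := fun _ => 1) continuous_const).abs
  rw [mollify, mollify, ← integral_sub (hi x) (hi y), ← integral_const_mul]
  refine (abs_integral_le_integral_abs).trans
    (integral_mono ((hi x).sub (hi y)).abs (hi2.const_mul A) fun t => ?_)
  simp only
  rw [← sub_mul, abs_mul]
  by_cases ht : ‖t‖ ≤ ε * √d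
  · exact mul_le_mul_of_nonneg_right (h t ht) (abs_nonneg _)
  · rw [productKernel_eq_zero hε hs n (not_le.1 ht)]
    simp

end Mollification

/-- Mollification at scale `ε √d` such that each further partial derivative costs a factor that
does not depend on the dimension. -/
theorem exists_mollification (k : ℕ) {ε : ℝ} (hε : 0 < ε) :
    ∃ C : ℝ, 1 ≤ C ∧ ∀ (d : ℕ) (g : E d → ℝ), ContDiff ℝ 1 g → ∃ F : E d → ℝ,
      ContDiff ℝ k F ∧
      (∀ x c, (∀ y, ‖x - y‖ ≤ ε * √d → c ≤ g y) → c ≤ F x) ∧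
      (∀ x c, (∀ y, ‖x - y‖ ≤ ε * √d → g y ≤ c) → F x ≤ c) ∧
      (∀ x y A, (∀ t, ‖t‖ ≤ ε * √d → |g (x - t) - g (y - t)| ≤ A) → |F x - F y| ≤ A) ∧
      ∀ Λ, (∀ a x y, |fderiv ℝ g x (EuclideanSpace.single a 1) -
          fderiv ℝ g y (EuclideanSpace.single a 1)| ≤ Λ * ‖x - y‖) →
        ∀ j < k, ∀ (i : Fin (j + 1) → Fin d) x y,
          |partialDeriv (j + 1) i F x - partialDeriv (j + 1) i F y| ≤ C * Λ * ‖x - y‖ := by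
  obtain ⟨ρ, hρ, hρ0, hρ1, hs, M, hM, hρM⟩ := exists_smooth_bump k hε
  refine ⟨M ^ k, one_le_pow₀ hM, fun d g hg => ⟨mollify ρ 0 g,
    (contDiff_mollify hε.le hs hρ 0 hg.continuous).of_le (by exact_mod_cast le_top), ?_, ?_, ?_, ?_⟩⟩
  · intro x c h
    have := integral_mono (μ := (volume : Measure (E d)))
      (f := fun t => c * productKernel ρ 0 t) (g := fun t => g (x - t) * productKernel ρ 0 t)
      (integrable_mul_productKernel hε.le hs hρ 0 continuous_const)
      (integrable_mul_productKernel hε.le hs hρ 0 (hg.continuous.comp (by fun_prop))) fun t => ?_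
    · rwa [integral_const_mul, integral_productKernel_zero hρ1, mul_one] at this
    · have hp : 0 ≤ productKernel ρ 0 t := Finset.prod_nonneg fun l _ => by simpa using hρ0 _
      by_cases ht : ‖t‖ ≤ ε * √d
      · exact mul_le_mul_of_nonneg_right (h _ (by simpa using ht)) hp
      · simp [productKernel_eq_zero hε.le hs 0 (not_le.1 ht)]
  · intro x c h
    have := integral_mono (μ := (volume : Measure (E d)))
      (f := fun t => g (x - t) * productKernel ρ 0 t) (g := fun t => c * productKernel ρ 0 t)
      (integrable_mul_productKernel hε.le hs hρ 0 (hg.continuous.comp (by fun_prop)))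
      (integrable_mul_productKernel hε.le hs hρ 0 continuous_const) fun t => ?_
    · rwa [integral_const_mul, integral_productKernel_zero hρ1, mul_one] at this
    · have hp : 0 ≤ productKernel ρ 0 t := Finset.prod_nonneg fun l _ => by simpa using hρ0 _
      by_cases ht : ‖t‖ ≤ ε * √d
      · exact mul_le_mul_of_nonneg_right (h _ (by simpa using ht)) hp
      · simp [productKernel_eq_zero hε.le hs 0 (not_le.1 ht)]
  · intro x y A h
    refine (abs_mollify_sub_le hε.le hs hρ 0 hg.continuous h).trans (le_of_eq ?_)
    have : ∀ t : E d, |productKernel ρ 0 t| = productKernel ρ 0 t := fun t =>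
      abs_of_nonneg (Finset.prod_nonneg fun l _ => by simpa using hρ0 _)
    simp_rw [this]
    rw [integral_productKernel_zero hρ1, mul_one]
  · intro Λ hΛ j hj i x y
    have hgc : Continuous (fun y => fderiv ℝ g y (EuclideanSpace.single (i (Fin.last j)) 1)) :=
      (hg.continuous_fderiv one_ne_zero).clm_apply continuous_const
    -- Of the j + 1 derivatives the last falls on g, and the other j stay on the kernel.
    rw [partialDeriv_mollify hε.le hs hρ hg.continuous, partialDeriv_mollify hε.le hs hρ
      hg.continuous, Fin.sum_univ_castSucc, ← add_assoc, mollify_add_single hε.le hs hρ _ hg,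
      mollify_add_single hε.le hs hρ _ hg]
    refine (abs_mollify_sub_le hε.le hs hρ _ hgc (A := Λ * ‖x - y‖) fun t _ => ?_).trans ?_
    · simpa using hΛ (i (Fin.last j)) (x - t) (y - t)
    · have h0 : 0 ≤ Λ * ‖x - y‖ := (abs_nonneg _).trans (hΛ (i (Fin.last j)) x y)
      rw [mul_assoc (M ^ k), mul_comm (M ^ k)]
      refine mul_le_mul_of_nonneg_left (integral_abs_productKernel_le hρ0 hρ1 hM hρM ?_) h0
      simp only [zero_add, Finset.sum_apply]
      rw [Finset.sum_comm]
      simp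
      omega

/-! ### Fooling functions and the lower bound -/

theorem infDist_le_infDist_cthickening_add {d : ℕ} {K : Set (E d)} (hK : K.Nonempty) {δ : ℝ}
    (hδ : 0 ≤ δ) (y : E d) :
    Metric.infDist y K ≤ Metric.infDist y (Metric.cthickening δ K) + δ := by
  obtain ⟨w, hw, hyw⟩ := Metric.isClosed_cthickening.exists_infDist_eq_dist
    (hK.mono (Metric.self_subset_cthickening K)) y
  rw [hyw]
  have h1 : Metric.infDist w K ≤ δ := by
    rw [Metric.mem_cthickening_iff] at hw
    exact ENNReal.toReal_le_of_le_ofReal hδ hw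
  linarith [Metric.infDist_le_infDist_add_dist (s := K) (x := y) (y := w)]

/-- A smooth function vanishing at few prescribed points whose integral is bounded below. -/
theorem exists_fooling (k : ℕ) {ε : ℝ} (hε : 0 < ε) :
    ∃ C : ℝ, 0 < C ∧ ∀ (d : ℕ), 1 ≤ d → ∀ (D : Set (E d)) (q : ℝ), AdmissibleDomain D (3 * ε) q →
      ∀ s : Finset (E d), (s : Set (E d)) ⊆ D → s.Nonempty → s.card * q ^ d ≤ 1 / 2 →
      ∃ F : E d → ℝ, ContDiff ℝ k F ∧ (∀ x ∈ s, F x = 0) ∧ (∀ x ∈ D, |F x| ≤ C) ∧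
        (∀ x ∈ D, ∀ y ∈ D, |F x - F y| ≤ C / √d * ‖x - y‖) ∧
        (∀ j < k, ∀ (i : Fin (j + 1) → Fin d) x y,
          |partialDeriv (j + 1) i F x - partialDeriv (j + 1) i F y| ≤ C / d * ‖x - y‖) ∧
        ε ^ 2 / 2 ≤ ∫ x in D, F x := by
  obtain ⟨C, hC, hmol⟩ := exists_mollification k hε
  refine ⟨(2 + ε) ^ 2 + 2 * (2 + ε) + 2 * C, by positivity, ?_⟩
  intro d hd D q hD s hs hne hcard
  have hd0 : (0 : ℝ) < d := by exact_mod_cast hd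
  have hsd : 0 < √(d : ℝ) := Real.sqrt_pos.2 hd0
  have hsq : √(d : ℝ) ^ 2 = d := Real.sq_sqrt hd0.le
  set K := convexHull ℝ (s : Set (E d)) with hK
  have hKne : K.Nonempty := (convexHull_nonempty_iff (𝕜 := ℝ)).2 hne.to_set
  -- Thickening by the mollification radius keeps F equal to zero at the sample points.
  set K' := Metric.cthickening (ε * √d) K with hK'
  have hKK' : K ⊆ K' := Metric.self_subset_cthickening K
  obtain ⟨G, hG1, hG2⟩ := exists_hasFDerivAt_infDist_sq (Metric.isClosed_cthickening)
    ((convex_convexHull ℝ (s : Set (E d))).cthickening (ε * √d)) (hKne.mono hKK')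
  rw [← hK, ← hK'] at hG2
  set g : E d → ℝ := fun x => (1 / d : ℝ) * Metric.infDist x K' ^ 2 with hg
  have hgd : ∀ x, HasFDerivAt g ((1 / d : ℝ) • ((2 : ℝ) • innerSL ℝ (G x))) x := fun x =>
    (hG2 x).const_mul _
  have hgfd : ∀ x, fderiv ℝ g x = (1 / d : ℝ) • ((2 : ℝ) • innerSL ℝ (G x)) :=
    fun x => (hgd x).fderiv
  have hGc : Continuous G := by
    have : LipschitzWith 1 G := LipschitzWith.of_dist_le_mul fun x y => by
      simpa [dist_eq_norm] using hG1 x y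
    exact this.continuous
  have hgC1 : ContDiff ℝ 1 g := by
    rw [contDiff_one_iff_fderiv]
    refine ⟨fun x => (hgd x).differentiableAt, ?_⟩
    rw [show fderiv ℝ g = _ from funext hgfd]
    fun_prop
  obtain ⟨F, hF, hlow, hupp, hlip, hder⟩ := hmol d g hgC1
  obtain ⟨z, hz⟩ := hD.exists_subset_closedBall
  obtain ⟨p, hp⟩ := hne
  have hdist : ∀ x ∈ D, ∀ y, ‖x - y‖ ≤ ε * √d → Metric.infDist y K' ≤ (2 + ε) * √d := by
    intro x hx y hxy
    have h1 : Metric.infDist y K' ≤ dist y p :=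
      Metric.infDist_le_dist_of_mem (hKK' (subset_convexHull ℝ _ hp))
    have h2 := hz hx
    have h3 := hz (hs hp)
    rw [Metric.mem_closedBall] at h2 h3
    rw [← dist_eq_norm, dist_comm] at hxy
    have h4 := dist_triangle y x p
    have h5 := dist_triangle_right x p z
    nlinarith
  have hF0 : ∀ x, 0 ≤ F x := fun x => hlow x 0 fun y _ => by positivity
  have hFu : ∀ x ∈ D, F x ≤ (2 + ε) ^ 2 := fun x hx => hupp x _ fun y hy => by
    have := pow_le_pow_left₀ Metric.infDist_nonneg (hdist x hx y hy) 2
    rw [mul_pow, hsq] at this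
    simp only [hg]
    rw [div_mul_eq_mul_div, one_mul, div_le_iff₀ hd0]
    exact this
  have hFC : ∀ x ∈ D, |F x| ≤ (2 + ε) ^ 2 + 2 * (2 + ε) + 2 * C := fun x hx => by
    rw [abs_of_nonneg (hF0 x)]
    linarith [hFu x hx]
  refine ⟨F, hF, fun x hx => ?_, hFC, fun x hx y hy => ?_, fun j hj i x y => ?_, ?_⟩
  · refine le_antisymm (hupp x 0 fun y hy => ?_) (hF0 x)
    have hyK : y ∈ K' := by
      refine Metric.mem_cthickening_of_dist_le y x _ _ (subset_convexHull ℝ _ hx) ?_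
      rw [dist_comm, dist_eq_norm]
      exact hy
    simp [hg, Metric.infDist_zero_of_mem hyK]
  · refine (hlip x y (2 * (2 + ε) / √d * ‖x - y‖) fun t ht => ?_).trans ?_
    · have h1 := hdist x hx (x - t) (by simpa using ht)
      have h2 := hdist y hy (y - t) (by simpa using ht)
      have h3 : |Metric.infDist (x - t) K' - Metric.infDist (y - t) K'| ≤ ‖x - y‖ := by
        have := (Metric.lipschitz_infDist_pt K').dist_le_mul (x - t) (y - t)
        rw [Real.dist_eq] at this
        simpa [dist_eq_norm] using this
      have e : g (x - t) - g (y - t) = (1 / d : ℝ) *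
          ((Metric.infDist (x - t) K' - Metric.infDist (y - t) K') *
            (Metric.infDist (x - t) K' + Metric.infDist (y - t) K')) := by
        simp only [hg]; ring
      have h4 : 0 ≤ Metric.infDist (x - t) K' + Metric.infDist (y - t) K' :=
        add_nonneg Metric.infDist_nonneg Metric.infDist_nonneg
      rw [e, abs_mul, abs_mul, abs_of_nonneg h4, abs_of_pos (by positivity : 0 < (1 / d : ℝ))]
      calc (1 / d : ℝ) * (|Metric.infDist (x - t) K' - Metric.infDist (y - t) K'| *
            (Metric.infDist (x - t) K' + Metric.infDist (y - t) K'))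
          ≤ (1 / d : ℝ) * (‖x - y‖ * (2 * (2 + ε) * √d)) := by
            gcongr
            linarith
        _ = 2 * (2 + ε) / √d * ‖x - y‖ := by
            rw [show (1 / d : ℝ) = 1 / √d ^ 2 by rw [hsq]]
            field_simp
    · gcongr
      nlinarith [sq_nonneg (2 + ε)]
  · refine (hder (2 / d) (fun a x y => ?_) j hj i x y).trans ?_
    · rw [hgfd, hgfd]
      have e : ((1 / d : ℝ) • (2 : ℝ) • innerSL ℝ (G x)) (EuclideanSpace.single a 1) -
          ((1 / d : ℝ) • (2 : ℝ) • innerSL ℝ (G y)) (EuclideanSpace.single a 1) =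
          2 / d * inner ℝ (G x - G y) (EuclideanSpace.single a 1) := by
        rw [inner_sub_left]
        simp only [smul_apply, innerSL_apply_apply, smul_eq_mul]
        ring
      rw [e, abs_mul, abs_of_pos (by positivity : 0 < (2 / d : ℝ))]
      gcongr
      refine (abs_real_inner_le_norm _ _).trans ?_
      simpa using hG1 x y
    · rw [mul_div_assoc', mul_comm C 2]
      gcongr
      nlinarith [sq_nonneg (2 + ε)]
  -- Outside S the distance to K exceeds 3ε√d. The thickening and the mollification cost ε√d each,
  -- leaving ε√d and hence F ≥ ε².
  · set S := {x | Metric.infDist x K ≤ 3 * ε * √d} with hS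
    have hSm : MeasurableSet S :=
      (isClosed_le (Metric.continuous_infDist_pt K) continuous_const).measurableSet
    have hDm := hD.isOpen.measurableSet
    have hvol : volume.real (D ∩ S) ≤ 1 / 2 := (hD.hullBound s hs ⟨p, hp⟩).trans hcard
    have hDfin : volume D ≠ ⊤ := by rw [hD.volume_eq_one]; exact ENNReal.one_ne_top
    have hvD : volume.real D = 1 := by simp [measureReal_def, hD.volume_eq_one]
    have hdiff : 1 / 2 ≤ volume.real (D \ S) := by
      have := measureReal_inter_add_sdiff (μ := volume) (s := D) hSm hDfin
      linarith
    have hint : IntegrableOn F D := Measure.integrableOn_of_bounded hDfin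
      hF.continuous.aestronglyMeasurable ((ae_restrict_iff' hDm).2 (Eventually.of_forall hFC))
    have hge : ∀ x ∈ D \ S, ε ^ 2 ≤ F x := by
      intro x hx
      refine hlow x _ fun y hy => ?_
      have h1 : 3 * ε * √d < Metric.infDist x K := not_le.1 hx.2
      have h2 := Metric.infDist_le_infDist_add_dist (s := K) (x := x) (y := y)
      have h3 := infDist_le_infDist_cthickening_add hKne (by positivity : 0 ≤ ε * √d) y
      rw [dist_eq_norm] at h2
      have h4 : ε * √d ≤ Metric.infDist y K' := by linarith
      have h5 := pow_le_pow_left₀ (by positivity) h4 2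
      rw [mul_pow, hsq] at h5
      simp only [hg]
      rw [div_mul_eq_mul_div, one_mul, le_div_iff₀ hd0]
      exact h5
    calc ε ^ 2 / 2 ≤ ε ^ 2 * volume.real (D \ S) := by nlinarith [sq_nonneg ε]
      _ = ∫ x in D \ S, ε ^ 2 := by rw [setIntegral_const, smul_eq_mul, mul_comm]
      _ ≤ ∫ x in D \ S, F x := setIntegral_mono_on
          (integrableOn_const (measure_ne_top_of_subset sdiff_subset hDfin))
          (hint.mono_set sdiff_subset) (hDm.diff hSm) hge
      _ ≤ ∫ x in D, F x := setIntegral_mono_set hint (Eventually.of_forall hF0)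
          sdiff_subset.eventuallyLE

theorem partialDeriv_const_mul {d k j : ℕ} (hj : j ≤ k) {F : E d → ℝ} (hF : ContDiff ℝ k F) (η : ℝ)
    (i : Fin j → Fin d) (x : E d) :
    partialDeriv j i (fun x => η * F x) x = η * partialDeriv j i F x := by
  have : ContDiffAt ℝ j F x := (hF.of_le (by exact_mod_cast hj)).contDiffAt
  have h := iteratedFDeriv_const_smul_apply (a := η) this
  rw [partialDeriv, partialDeriv, show (fun x => η * F x) = η • F from rfl, h]
  rfl

theorem Algorithm.values_congr {d : ℕ} {D : Set (E d)} (A : Algorithm D) {f g : E d → ℝ} {n : ℕ}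
    (h : ∀ m < n, f (A.node (A.values g m)) = g (A.node (A.values g m))) :
    A.values f n = A.values g n := by
  induction n with
  | zero => rfl
  | succ n ih =>
    have := ih fun m hm => h m (hm.trans n.lt_succ_self)
    rw [Algorithm.values, Algorithm.values, this, h n n.lt_succ_self]

theorem ofReal_le_infoComplexity {d : ℕ} {D : Set (E d)} {F : Set (E d → ℝ)} {ε r : ℝ}
    (h : ∀ n : ℕ, ∀ A : Algorithm D, A.ErrorLE n F ε → r ≤ n) :
    ENNReal.ofReal r ≤ ((infoComplexity D F ε : ℕ∞) : ℝ≥0∞) := by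
  have h1 : ((⌈r⌉₊ : ℕ) : ℕ∞) ≤ infoComplexity D F ε := by
    refine le_iInf₂ fun n hn => ?_
    obtain ⟨A, hA⟩ := hn
    exact_mod_cast Nat.ceil_le.2 (h n A hA)
  refine le_trans ?_ (ENat.toENNReal_le.2 h1)
  rw [ENat.toENNReal_coe]
  exact ENNReal.ofReal_le_of_le_toReal (by simpa using Nat.le_ceil r)

/-- Adversary argument: the nodes are those the algorithm visits when it reads only zeros. It
returns the same output for ηF and -ηF, whose integrals differ by at least ηε², whereas errors at
most ηε²/4 allow only ηε²/2. -/
theorem curseOfDimensionality_of_frequently {D : ∀ d : ℕ, Set (E d)} {ε q δ : ℝ} {k : ℕ}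
    {L : ℕ → ℕ → ℝ} (hε : 0 < ε) (hq : 0 < q) (hq1 : q < 1) (hδ : 0 < δ)
    (hD : ∀ᶠ d in atTop, AdmissibleDomain (D d) (3 * ε) q)
    (hL : ∃ᶠ d : ℕ in atTop, δ ≤ L 0 d * √d ∧ ∀ j < k, δ ≤ L (j + 1) d * d) :
    CurseOfDimensionality D (fun d => partialClass (D d) k (fun j => L j d)) := by
  obtain ⟨C, hC, hfool⟩ := exists_fooling k hε
  set η := min δ 1 / C with hη
  have hη0 : 0 < η := by positivity
  have hηδ : η * C ≤ δ := by rw [hη, div_mul_cancel₀ _ hC.ne']; exact min_le_left _ _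
  have hη1 : η * C ≤ 1 := by rw [hη, div_mul_cancel₀ _ hC.ne']; exact min_le_right _ _
  -- If n < q^(-d)/4 and q^(-d) ≥ 4, then (n + 1) q^d ≤ 1/2, as the fooling function requires.
  refine ⟨1 / 4, η * ε ^ 2 / 4, 1 / q - 1, by norm_num, by positivity, ?_, ?_⟩
  · rw [sub_pos, lt_div_iff₀ hq]; linarith
  intro e he0 he
  have hlarge : ∀ᶠ d : ℕ in atTop, 4 ≤ (1 / q) ^ d :=
    (tendsto_pow_atTop_atTop_of_one_lt (by rw [lt_div_iff₀ hq]; linarith)).eventually_ge_atTop 4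
  refine (hL.and_eventually (hD.and (hlarge.and (eventually_ge_atTop 1)))).mono ?_
  rintro d ⟨⟨hL0, hLj⟩, hDd, hd4, hd⟩
  have hd0 : (0 : ℝ) < d := by exact_mod_cast hd
  have hsd : 0 < √(d : ℝ) := Real.sqrt_pos.2 hd0
  rw [show 1 + (1 / q - 1) = 1 / q by ring]
  refine ofReal_le_infoComplexity fun n A hA => ?_
  by_contra hn
  rw [not_le] at hn
  classical
  -- One node more than needed, so that s is nonempty also for n = 0.
  set s : Finset (E d) := (Finset.range (n + 1)).image fun m => A.node (A.values 0 m) with hs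
  have hsD : (s : Set (E d)) ⊆ D d := by
    intro x hx
    obtain ⟨m, -, rfl⟩ := Finset.mem_image.1 hx
    exact A.node_mem _
  have hscard : (s.card : ℝ) * q ^ d ≤ 1 / 2 := by
    have h1 : (s.card : ℝ) ≤ n + 1 := by
      exact_mod_cast Finset.card_image_le.trans (by simp)
    have h2 : (s.card : ℝ) ≤ 1 / 2 * (1 / q) ^ d := by linarith
    calc (s.card : ℝ) * q ^ d ≤ 1 / 2 * (1 / q) ^ d * q ^ d := by gcongr
      _ = 1 / 2 := by rw [mul_assoc, ← mul_pow, one_div_mul_cancel hq.ne', one_pow, mul_one]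
  obtain ⟨F, hF, hFs, hFC, hFL, hFj, hFint⟩ := hfool d hd (D d) q hDd s hsD
    (Finset.image_nonempty.2 (by simp)) hscard
  have hmem : ∀ σ : ℝ, |σ| = η →
      (fun x => σ * F x) ∈ partialClass (D d) k (fun j => L j d) := by
    intro σ hσ
    refine ⟨(contDiff_const.mul hF).contDiffOn, fun x hx => ?_, fun j hj i x hx y hy => ?_⟩
    · rw [abs_mul, hσ]
      exact (mul_le_mul_of_nonneg_left (hFC x hx) hη0.le).trans hη1
    · rw [partialDeriv_const_mul hj hF, partialDeriv_const_mul hj hF, ← mul_sub, abs_mul, hσ]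
      rcases j with _ | j
      · rw [partialDeriv_zero, partialDeriv_zero]
        calc η * |F x - F y| ≤ η * (C / √d * ‖x - y‖) := by gcongr; exact hFL x hx y hy
          _ = η * C / √d * ‖x - y‖ := by ring
          _ ≤ L 0 d * ‖x - y‖ := by
            gcongr
            rw [div_le_iff₀ hsd]
            linarith
      · calc η * |partialDeriv (j + 1) i F x - partialDeriv (j + 1) i F y|
            ≤ η * (C / d * ‖x - y‖) := by gcongr; exact hFj j (by omega) i x y
          _ = η * C / d * ‖x - y‖ := by ring
          _ ≤ L (j + 1) d * ‖x - y‖ := by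
            gcongr
            rw [div_le_iff₀ hd0]
            linarith [hLj j (by omega)]
  have hrun : ∀ σ : ℝ, A.run n (fun x => σ * F x) = A.run n 0 := by
    intro σ
    rw [Algorithm.run, Algorithm.run, Algorithm.values_congr]
    intro m hm
    have : A.node (A.values 0 m) ∈ s :=
      Finset.mem_image.2 ⟨m, Finset.mem_range.2 (by omega), rfl⟩
    simp [hFs _ this]
  have h1 := hA _ (hmem η (abs_of_pos hη0))
  have h2 := hA _ (hmem (-η) (by rw [abs_neg, abs_of_pos hη0]))
  rw [hrun, integral_const_mul, abs_le] at h1 h2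
  have h3 : η * (ε ^ 2 / 2) ≤ η * ∫ x in D d, F x := by gcongr
  have h4 : 0 < η * ε ^ 2 := by positivity
  linarith [h1.1, h1.2, h2.1, h2.2]

theorem exists_frequently_of_limsup_pos {k : ℕ} {L : ℕ → ℕ → ℝ}
    (h : 0 < limsup (fun d : ℕ => min ((L 0 d * Real.sqrt d : ℝ) : EReal)
      (⨅ j ∈ Finset.Icc 1 k, ((L j d * (d : ℝ) : ℝ) : EReal))) atTop) :
    ∃ δ : ℝ, 0 < δ ∧ ∃ᶠ d : ℕ in atTop, δ ≤ L 0 d * √d ∧ ∀ j < k, δ ≤ L (j + 1) d * d := by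
  obtain ⟨δ, hδ0, hδ⟩ := EReal.lt_iff_exists_real_btwn.1 h
  refine ⟨δ, by exact_mod_cast hδ0, (frequently_lt_of_lt_limsup (by isBoundedDefault) hδ).mono ?_⟩
  intro d hd
  rw [lt_min_iff] at hd
  refine ⟨by exact_mod_cast hd.1.le, fun j hj => ?_⟩
  have := hd.2.le.trans (iInf₂_le (j + 1) (Finset.mem_Icc.2 ⟨by omega, by omega⟩))
  exact_mod_cast this

/-! ### Taylor approximation on the class -/

section Taylor

theorem iteratedFDeriv_apply_eq_sum_partialDeriv {d m : ℕ} (f : E d → ℝ) (x v : E d) :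
    iteratedFDeriv ℝ m f x (fun _ => v) =
      ∑ i : Fin m → Fin d, (∏ l, v (i l)) * partialDeriv m i f x := by
  have hv : v = ∑ a, v a • EuclideanSpace.single a (1 : ℝ) := by
    ext b
    simp [Finset.sum_apply, Pi.single_apply]
  conv_lhs => rw [hv]
  rw [ContinuousMultilinearMap.map_sum]
  refine Finset.sum_congr rfl fun i _ => ?_
  rw [ContinuousMultilinearMap.map_smul_univ, smul_eq_mul, partialDeriv]

/-- The Taylor polynomial of degree `j` at `z`. -/
def taylorPoly {d : ℕ} (j : ℕ) (f : E d → ℝ) (z x : E d) : ℝ :=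
  ∑ m ∈ Finset.range (j + 1), ∑ i : Fin m → Fin d,
    ((m.factorial : ℝ)⁻¹ * partialDeriv m i f z) * ∏ l, (x - z) (i l)

theorem taylorPoly_eq_sum_iteratedFDeriv {d : ℕ} (j : ℕ) (f : E d → ℝ) (z x : E d) :
    taylorPoly j f z x = ∑ m ∈ Finset.range (j + 1),
      (m.factorial : ℝ)⁻¹ * iteratedFDeriv ℝ m f z (fun _ => x - z) := by
  refine Finset.sum_congr rfl fun m _ => ?_
  rw [iteratedFDeriv_apply_eq_sum_partialDeriv, Finset.mul_sum]
  exact Finset.sum_congr rfl fun i _ => by ring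

theorem sum_abs_le_sqrt_mul_norm {d : ℕ} (v : E d) : ∑ a, |v a| ≤ √d * ‖v‖ := by
  refine abs_le_of_sq_le_sq' ?_ (by positivity) |>.2
  rw [mul_pow, Real.sq_sqrt (Nat.cast_nonneg d), EuclideanSpace.norm_sq_eq]
  have := sq_sum_le_card_mul_sum_sq (s := Finset.univ) (f := fun a => |v a|)
  simpa using this

/-- Expanding in coordinates gives the m-th power of the ℓ¹ norm of v. For ‖v‖ of order √d this is
d^m, the source of the exponent j in d^(j+1/2); the Lipschitz bound supplies the remaining √d. -/
theorem abs_iteratedFDeriv_sub_le {d m : ℕ} {f : E d → ℝ} {x y v : E d} {B : ℝ}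
    (hB : 0 ≤ B) (h : ∀ i : Fin m → Fin d, |partialDeriv m i f x - partialDeriv m i f y| ≤ B) :
    |iteratedFDeriv ℝ m f x (fun _ => v) - iteratedFDeriv ℝ m f y (fun _ => v)| ≤
      (√d * ‖v‖) ^ m * B := by
  rw [iteratedFDeriv_apply_eq_sum_partialDeriv, iteratedFDeriv_apply_eq_sum_partialDeriv,
    ← Finset.sum_sub_distrib]
  have h1 : |∑ i : Fin m → Fin d, ((∏ l, v (i l)) * partialDeriv m i f x -
      (∏ l, v (i l)) * partialDeriv m i f y)| ≤ (∑ a, |v a|) ^ m * B := by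
    refine (Finset.abs_sum_le_sum_abs _ _).trans ?_
    rw [show (∑ a, |v a|) ^ m = ∑ i : Fin m → Fin d, ∏ l, |v (i l)| by
      rw [Finset.sum_pow']; simp, Finset.sum_mul]
    refine Finset.sum_le_sum fun i _ => ?_
    rw [← mul_sub, abs_mul, Finset.abs_prod]
    exact mul_le_mul_of_nonneg_left (h i) (Finset.prod_nonneg fun _ _ => abs_nonneg _)
  refine h1.trans ?_
  gcongr
  exact sum_abs_le_sqrt_mul_norm v

variable {d k : ℕ} {D : Set (E d)} {L : ℕ → ℝ} {f : E d → ℝ}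

theorem contDiffAt_of_mem_partialClass (hD : IsOpen D) (hf : f ∈ partialClass D k L) {x : E d}
    (hx : x ∈ D) {j : ℕ} (hj : j ≤ k) : ContDiffAt ℝ j f x :=
  (hf.1.contDiffAt (hD.mem_nhds hx)).of_le (by exact_mod_cast hj)

theorem abs_sub_taylorPoly_le (hD : IsOpen D) (hc : Convex ℝ D) (hf : f ∈ partialClass D k L)
    {j : ℕ} (hj : j ≤ k) (hL : 0 ≤ L j) {z x : E d} (hz : z ∈ D) (hx : x ∈ D) :
    |f x - taylorPoly j f z x| ≤ (√d * ‖x - z‖) ^ j * (L j * ‖x - z‖) := by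
  rw [taylorPoly_eq_sum_iteratedFDeriv]
  have hseg : ∀ t ∈ Icc (0 : ℝ) 1, z + t • (x - z) ∈ D := fun t ht =>
    hc.add_smul_sub_mem hz hx ht
  rcases j with _ | n
  · have := hf.2.2 0 hj Fin.elim0 x hx z hz
    rw [partialDeriv_zero, partialDeriv_zero] at this
    simpa using this
  have hcd : ∀ t ∈ Icc (0 : ℝ) 1, ContDiffAt ℝ (n + 1 : ℕ) f (z + t • (x - z)) := fun t ht =>
    contDiffAt_of_mem_partialClass hD hf (hseg t ht) hj
  have hT := map_add_eq_sum_add_integral_iteratedFDeriv (f := f) (x := z) (y := x - z) (n := n)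
    (fun t ht => by exact_mod_cast hcd t ht)
  rw [add_sub_cancel] at hT
  set φ : ℝ → ℝ := fun t => iteratedFDeriv ℝ (n + 1) f (z + t • (x - z)) (fun _ => x - z) with hφ
  have hφc : ContinuousOn φ (uIcc 0 1) := by
    rw [uIcc_of_le zero_le_one]
    intro t ht
    have h_cont : ContinuousAt (iteratedFDeriv ℝ (n + 1) f) (z + t • (x - z)) :=
      ((hcd t ht).iteratedFDeriv_right (i := n + 1) (m := 0) (by simp)).continuousAt
    exact (h_cont.comp (x := t) (by fun_prop)).continuousWithinAt.eval_const _
  have hpow : ∫ t in (0 : ℝ)..1, (1 - t) ^ n = ((n : ℝ) + 1)⁻¹ := by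
    rw [intervalIntegral.integral_comp_sub_left (fun t => t ^ n) 1, integral_pow]
    simp
  have hi1 : IntervalIntegrable (fun t => (1 - t) ^ n • φ t) volume 0 1 :=
    ContinuousOn.intervalIntegrable (by fun_prop)
  have hi2 : IntervalIntegrable (fun t => (1 - t) ^ n • φ 0) volume 0 1 :=
    Continuous.intervalIntegrable (by fun_prop) _ _
  -- The term of top degree is absorbed into the integral remainder, so that only differences of
  -- derivatives of order n + 1 occur and their Lipschitz bound suffices.
  have hrem : f x - ∑ m ∈ Finset.range (n + 1 + 1),
      (m.factorial : ℝ)⁻¹ * iteratedFDeriv ℝ m f z (fun _ => x - z) =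
      (n.factorial : ℝ)⁻¹ * ∫ t in (0 : ℝ)..1, (1 - t) ^ n • (φ t - φ 0) := by
    simp_rw [smul_sub]
    rw [intervalIntegral.integral_sub hi1 hi2, intervalIntegral.integral_smul_const, hpow, hT,
      Finset.sum_range_succ _ (n + 1), Nat.factorial_succ]
    simp only [hφ, smul_eq_mul, zero_smul, add_zero]
    push_cast
    field_simp
    ring
  rw [hrem, abs_mul]
  have hfac : |(n.factorial : ℝ)⁻¹| ≤ 1 := by
    rw [abs_of_nonneg (by positivity)]
    exact inv_le_one_of_one_le₀ (by exact_mod_cast n.factorial_pos)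
  have hbd : |∫ t in (0 : ℝ)..1, (1 - t) ^ n • (φ t - φ 0)| ≤
      (√d * ‖x - z‖) ^ (n + 1) * (L (n + 1) * ‖x - z‖) := by
    have := intervalIntegral.norm_integral_le_of_norm_le_const (a := (0 : ℝ)) (b := 1)
      (f := fun t => (1 - t) ^ n • (φ t - φ 0))
      (C := (√d * ‖x - z‖) ^ (n + 1) * (L (n + 1) * ‖x - z‖)) fun t ht => ?_
    · simpa using this
    · rw [uIoc_of_le zero_le_one] at ht
      have ht' : t ∈ Icc (0 : ℝ) 1 := ⟨ht.1.le, ht.2⟩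
      rw [norm_smul]
      have h1 : ‖(1 - t) ^ n‖ ≤ 1 := by
        rw [norm_pow]
        refine pow_le_one₀ (norm_nonneg _) ?_
        rw [Real.norm_eq_abs, abs_le]
        constructor <;> linarith [ht'.1, ht'.2]
      have h2 : ‖φ t - φ 0‖ ≤ (√d * ‖x - z‖) ^ (n + 1) * (L (n + 1) * ‖x - z‖) := by
        refine abs_iteratedFDeriv_sub_le (by positivity) fun i => ?_
        refine (hf.2.2 (n + 1) hj i _ (hseg t ht') _ (hseg 0 (by simp))).trans ?_
        gcongr
        rw [zero_smul, add_zero, add_sub_cancel_left, norm_smul, Real.norm_of_nonneg ht'.1]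
        exact mul_le_of_le_one_left (norm_nonneg _) ht'.2
      calc _ ≤ 1 * _ := mul_le_mul h1 h2 (norm_nonneg _) zero_le_one
        _ = _ := one_mul _
  calc _ ≤ 1 * _ := mul_le_mul hfac hbd (abs_nonneg _) zero_le_one
    _ = _ := one_mul _

/-- A derivative of a Lipschitz function is bounded by its Lipschitz constant. This bounds the
Taylor coefficients uniformly over the class. -/
theorem abs_partialDeriv_le (hD : IsOpen D) (hf : f ∈ partialClass D k L)
    {m : ℕ} (hm : m < k) (hL : 0 ≤ L m) (i : Fin (m + 1) → Fin d) {z : E d} (hz : z ∈ D) :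
    |partialDeriv (m + 1) i f z| ≤ L m := by
  have hd : DifferentiableAt ℝ (iteratedFDeriv ℝ m f) z :=
    (contDiffAt_of_mem_partialClass hD hf hz hm).differentiableAt_iteratedFDeriv
      (by exact_mod_cast m.lt_succ_self)
  have h1 : partialDeriv (m + 1) i f z =
      fderiv ℝ (partialDeriv m (Fin.tail i) f) z (EuclideanSpace.single (i 0) 1) :=
    hd.iteratedFDeriv_succ_apply_left'
  have h2 : ‖fderiv ℝ (partialDeriv m (Fin.tail i) f) z‖ ≤ L m := by
    refine norm_fderiv_le_of_lip' ℝ hL ?_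
    filter_upwards [hD.mem_nhds hz] with x hx
    exact hf.2.2 m hm.le _ x hx z hz
  rw [h1, ← Real.norm_eq_abs]
  refine (ContinuousLinearMap.le_opNorm _ _).trans ?_
  simpa using h2

end Taylor

/-! ### Cubature and the upper bound -/

section Cubature

/-- Averages over a probability measure are approximated by convex combinations of few values. -/
theorem exists_cubature {d : ℕ} {D : Set (E d)} (hDm : MeasurableSet D) (hvol : volume D = 1)
    {ι : Type*} [Fintype ι] {Φ : E d → ι → ℝ} (hΦ : IntegrableOn Φ D) {τ : ℝ} (hτ : 0 < τ) :
    ∃ n ≤ Fintype.card ι + 1, ∃ (p : Fin n → E d) (w : Fin n → ℝ), (∀ m, p m ∈ D) ∧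
      (∀ m, 0 ≤ w m) ∧ ∑ m, w m = 1 ∧
      ∀ i, |(∫ x in D, Φ x i) - ∑ m, w m * Φ (p m) i| ≤ τ := by
  have : IsProbabilityMeasure (volume.restrict D) := ⟨by simpa using hvol⟩
  have hmem : ∫ x in D, Φ x ∈ closure (convexHull ℝ (Φ '' D)) := by
    refine (convex_convexHull ℝ _).closure.integral_mem isClosed_closure ?_ hΦ
    refine (ae_restrict_iff' hDm).2 (Eventually.of_forall fun x hx => ?_)
    exact subset_closure (subset_convexHull ℝ _ (mem_image_of_mem _ hx))
  obtain ⟨y, hy, hdist⟩ := Metric.mem_closure_iff.1 hmem τ hτ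
  -- Carathéodory: affine independence of the points bounds their number by the dimension plus one.
  obtain ⟨κ, hκ, z, w, hz, haff, hw0, hw1, hwz⟩ := eq_pos_convex_span_of_mem_convexHull hy
  have hcard : Fintype.card κ ≤ Fintype.card ι + 1 := by
    refine haff.card_le_finrank_succ.trans ?_
    gcongr
    refine (Submodule.finrank_le _).trans ?_
    simp
  have hpre : ∀ a, ∃ x ∈ D, Φ x = z a := fun a => hz (mem_range_self a)
  choose p hpD hpz using hpre
  let e := (Fintype.equivFin κ).symm
  refine ⟨Fintype.card κ, hcard, fun m => p (e m), fun m => w (e m), fun m => hpD _,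
    fun m => (hw0 _).le, ?_, fun i => ?_⟩
  · rw [← hw1]
    exact e.sum_comp w
  · have h1 : ∑ m, w (e m) * Φ (p (e m)) i = y i := by
      rw [← hwz, e.sum_comp fun a => w a * Φ (p a) i, Finset.sum_apply]
      exact Finset.sum_congr rfl fun a _ => by rw [hpz]; rfl
    have h2 : ∫ x in D, Φ x i = (∫ x in D, Φ x) i :=
      (eval_integral (fun i => hΦ.eval i) i).symm
    rw [h1, h2, ← Real.dist_eq]
    exact (dist_le_pi_dist _ _ i).trans hdist.le

theorem exists_algorithm_of_nodes {d n : ℕ} {D : Set (E d)} (hD : D.Nonempty) (p : Fin n → E d)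
    (w : Fin n → ℝ) (hp : ∀ m, p m ∈ D) :
    ∃ A : Algorithm D, ∀ f, A.run n f = ∑ m, w m * f (p m) := by
  obtain ⟨z, hz⟩ := hD
  let A : Algorithm D :=
    { node := fun v => if h : v.length < n then p ⟨v.length, h⟩ else z
      node_mem := fun v => by
        split_ifs
        · exact hp _
        · exact hz
      output := fun v => ∑ m : Fin n, w m * v.getD m 0 }
  refine ⟨A, fun f => ?_⟩
  have hlen : ∀ m, (A.values f m).length = m := by
    intro m
    induction m with
    | zero => rfl
    | succ m ih => simp [Algorithm.values, ih]
  have hval : ∀ m ≤ n, ∀ l : Fin n, (l : ℕ) < m → (A.values f m).getD l 0 = f (p l) := by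
    intro m hm
    induction m with
    | zero => intro l hl; omega
    | succ m ih =>
      intro l hl
      rw [Algorithm.values]
      rcases Nat.lt_succ_iff_lt_or_eq.1 hl with h | h
      · rw [List.getD_append _ _ _ _ (by rw [hlen]; exact h)]
        exact ih (by omega) l h
      · rw [List.getD_append_right _ _ _ _ (by rw [hlen]; omega), hlen, h]
        have : A.node (A.values f m) = p l := by
          have h3 : (A.values f m).length < n := by rw [hlen]; omega
          have h4 : A.node (A.values f m) = p ⟨(A.values f m).length, h3⟩ := dif_pos h3
          rw [h4]
          congr 1
          ext
          simp [hlen, h]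
        simp [this]
  change ∑ m : Fin n, w m * (A.values f n).getD m 0 = _
  exact Finset.sum_congr rfl fun m _ => by rw [hval n le_rfl m m.2]

end Cubature

/-- Three errors of size B add up: replacing f by its Taylor polynomial in the integral, the
cubature of that polynomial, and replacing it by f at the nodes, where positive weights of sum one
do not amplify the error. -/
theorem infoComplexity_le_of_taylor {d k : ℕ} (hd : 1 ≤ d) {D : Set (E d)} {ε q : ℝ}
    (hD : AdmissibleDomain D ε q) {L : ℕ → ℝ} (hL : ∀ j ≤ k, 0 ≤ L j) {j : ℕ} (hj : j ≤ k) {B : ℝ}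
    (hB0 : 0 < B) (hB : (√d * (2 * √d)) ^ j * (L j * (2 * √d)) ≤ B) :
    infoComplexity D (partialClass D k L) (3 * B) ≤ ((((j + 1) * d ^ j + 1 : ℕ)) : ℕ∞) := by
  have hDm := hD.isOpen.measurableSet
  have hDfin : volume D ≠ ⊤ := by rw [hD.volume_eq_one]; exact ENNReal.one_ne_top
  have hDone : volume.real D = 1 := by simp [measureReal_def, hD.volume_eq_one]
  have hDne : D.Nonempty := nonempty_of_measure_ne_zero (μ := volume) (by simp [hD.volume_eq_one])
  obtain ⟨z, hz⟩ := hDne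
  obtain ⟨c, hc⟩ := hD.exists_subset_closedBall
  have hdiam : ∀ x ∈ D, ‖x - z‖ ≤ 2 * √d := by
    intro x hx
    have h1 := hc hx
    have h2 := hc hz
    rw [Metric.mem_closedBall] at h1 h2
    rw [← dist_eq_norm]
    linarith [dist_triangle_right x z c]
  let ι := Σ m : Fin (j + 1), (Fin m → Fin d)
  have hcard : Fintype.card ι ≤ (j + 1) * d ^ j := by
    rw [Fintype.card_sigma]
    refine (Finset.sum_le_card_nsmul _ _ (d ^ j) fun m _ => ?_).trans (by simp)
    rw [Fintype.card_fun, Fintype.card_fin, Fintype.card_fin]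
    exact Nat.pow_le_pow_right hd (Nat.lt_succ_iff.1 m.2)
  let Φ : E d → ι → ℝ := fun x a => ∏ l, (x - z) (a.2 l)
  have hΦc : Continuous Φ := by
    refine continuous_pi fun a => ?_
    fun_prop
  have hΦ : IntegrableOn Φ D :=
    (hΦc.continuousOn.integrableOn_compact (isCompact_closedBall c √d)).mono_set hc
  set M : ℝ := 1 + ∑ m ∈ Finset.range j, L m with hM
  have hsum0 : ∀ m ∈ Finset.range j, 0 ≤ L m := fun m hm =>
    hL m (by have := Finset.mem_range.1 hm; omega)
  have hM0 : 0 < M := by have := Finset.sum_nonneg hsum0; positivity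
  -- The tolerance is fixed before f: the coefficients of every f in the class are at most M, so all
  -- monomials together contribute at most B.
  have hτ : 0 < B / ((Fintype.card ι + 1) * M) := by positivity
  obtain ⟨n, hn, p, w, hpD, hw0, hw1, hcub⟩ := exists_cubature hDm hD.volume_eq_one hΦ hτ
  obtain ⟨A, hA⟩ := exists_algorithm_of_nodes ⟨z, hz⟩ p w hpD
  refine (iInf₂_le n ⟨A, ?_⟩).trans (by exact_mod_cast hn.trans (by omega))
  intro f hf
  rw [hA]
  let cf : ι → ℝ := fun a => ((a.1 : ℕ).factorial : ℝ)⁻¹ * partialDeriv a.1 a.2 f z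
  have hcf : ∀ a, |cf a| ≤ M := by
    rintro ⟨⟨m, hm⟩, i⟩
    simp only [cf]
    rw [abs_mul, abs_of_nonneg (by positivity)]
    have hfac : ((m.factorial : ℝ))⁻¹ ≤ 1 :=
      inv_le_one_of_one_le₀ (by exact_mod_cast m.factorial_pos)
    have hpd : |partialDeriv m i f z| ≤ M := by
      rcases m with _ | m
      · rw [partialDeriv_zero]
        have := Finset.sum_nonneg hsum0
        linarith [hf.2.1 z hz]
      · have h1 := abs_partialDeriv_le hD.isOpen hf (by omega) (hL m (by omega)) i hz
        have h2 := Finset.single_le_sum hsum0 (Finset.mem_range.2 (by omega : m < j))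
        linarith
    exact (mul_le_of_le_one_left (abs_nonneg _) hfac).trans hpd
  have htay : ∀ x, taylorPoly j f z x = ∑ a, cf a * Φ x a := by
    intro x
    rw [Fintype.sum_sigma, taylorPoly, ← Fin.sum_univ_eq_sum_range
      (fun m => ∑ i : Fin m → Fin d,
        ((m.factorial : ℝ)⁻¹ * partialDeriv m i f z) * ∏ l, (x - z) (i l))]
  have herr : ∀ x ∈ D, |f x - taylorPoly j f z x| ≤ B := by
    intro x hx
    refine (abs_sub_taylorPoly_le hD.isOpen hD.convex hf hj (hL j hj) hz hx).trans (le_trans ?_ hB)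
    have h0 := hL j hj
    have h1 := hdiam x hx
    gcongr
  have hΦi : ∀ a, IntegrableOn (fun x => cf a * Φ x a) D := fun a => (hΦ.eval a).const_mul _
  have hTint : IntegrableOn (fun x => taylorPoly j f z x) D := by
    simp_rw [htay]
    exact integrable_finsetSum _ fun a _ => hΦi a
  have : IsFiniteMeasure (volume.restrict D) := isFiniteMeasure_restrict.2 hDfin
  have hfint : IntegrableOn f D := Integrable.of_bound
    (hf.1.continuousOn.aestronglyMeasurable hDm) 1
    ((ae_restrict_iff' hDm).2 (Eventually.of_forall hf.2.1))
  have e1 : |(∫ x in D, f x) - ∫ x in D, taylorPoly j f z x| ≤ B := by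
    rw [← integral_sub hfint hTint]
    have := norm_setIntegral_le_of_norm_le_const (μ := volume) (s := D)
      (f := fun x => f x - taylorPoly j f z x) (C := B) (lt_top_iff_ne_top.2 hDfin) herr
    rwa [hDone, mul_one] at this
  have e2 : |(∫ x in D, taylorPoly j f z x) - ∑ m, w m * taylorPoly j f z (p m)| ≤ B := by
    simp_rw [htay]
    rw [integral_finsetSum _ fun a _ => hΦi a]
    simp_rw [Finset.mul_sum]
    rw [Finset.sum_comm, ← Finset.sum_sub_distrib]
    have hterm : ∀ a, |(∫ x in D, cf a * Φ x a) - ∑ m, w m * (cf a * Φ (p m) a)| ≤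
        M * (B / ((Fintype.card ι + 1) * M)) := by
      intro a
      have : ∑ m, w m * (cf a * Φ (p m) a) = cf a * ∑ m, w m * Φ (p m) a := by
        rw [Finset.mul_sum]
        exact Finset.sum_congr rfl fun m _ => by ring
      rw [this, integral_const_mul, ← mul_sub, abs_mul]
      exact mul_le_mul (hcf a) (hcub a) (abs_nonneg _) hM0.le
    refine (Finset.abs_sum_le_sum_abs _ _).trans
      ((Finset.sum_le_card_nsmul _ _ _ fun a _ => hterm a).trans ?_)
    rw [nsmul_eq_mul, Finset.card_univ]
    have : M * (B / ((Fintype.card ι + 1) * M)) = B / (Fintype.card ι + 1) := by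
      field_simp
    rw [this, mul_div_assoc', div_le_iff₀ (by positivity)]
    nlinarith
  have e3 : |(∑ m, w m * taylorPoly j f z (p m)) - ∑ m, w m * f (p m)| ≤ B := by
    rw [← Finset.sum_sub_distrib]
    calc |∑ m, (w m * taylorPoly j f z (p m) - w m * f (p m))|
        ≤ ∑ m, |w m * taylorPoly j f z (p m) - w m * f (p m)| := Finset.abs_sum_le_sum_abs _ _
      _ ≤ ∑ m, w m * B := Finset.sum_le_sum fun m _ => by
          rw [← mul_sub, abs_mul, abs_of_nonneg (hw0 m), abs_sub_comm]
          exact mul_le_mul_of_nonneg_left (herr _ (hpD m)) (hw0 m)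
      _ = B := by rw [← Finset.sum_mul, hw1, one_mul]
  rw [abs_le] at e1 e2 e3 ⊢
  constructor <;> linarith [e1.1, e1.2, e2.1, e2.2, e3.1, e3.2]

theorem not_curseOfDimensionality {D : ∀ d : ℕ, Set (E d)} {ε q : ℝ} {k : ℕ}
    {L : ℕ → ℕ → ℝ} (hL : ∀ j ≤ k, ∀ d, 1 ≤ d → 0 < L j d)
    (hD : ∀ᶠ d in atTop, AdmissibleDomain (D d) ε q) {j : ℕ} (hj : j ≤ k)
    (hlim : Tendsto (fun d : ℕ => L j d * (d : ℝ) ^ ((j : ℝ) + 1 / 2)) atTop (𝓝 0)) :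
    ¬ CurseOfDimensionality D (fun d => partialClass (D d) k (fun j => L j d)) := by
  rintro ⟨c, e, γ, hc, he, hγ, hcurse⟩
  -- The Taylor error bound equals 2^(j+1) L_j d^(j+1/2), and it has to stay below a third of the
  -- accuracy e.
  have hsmall : ∀ᶠ d : ℕ in atTop,
      L j d * (d : ℝ) ^ ((j : ℝ) + 1 / 2) < e / 3 / 2 ^ (j + 1) :=
    hlim.eventually_lt_const (by positivity)
  have hgrow : Tendsto (fun d : ℕ => ((j + 1) * (d : ℝ) ^ j + 1) / (1 + γ) ^ d) atTop (𝓝 0) := by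
    have h1 := tendsto_pow_const_div_const_pow_of_one_lt j (by linarith : 1 < 1 + γ)
    have h0 := tendsto_pow_const_div_const_pow_of_one_lt 0 (by linarith : 1 < 1 + γ)
    have := (h1.const_mul ((j : ℝ) + 1)).add h0
    simp only [mul_zero, add_zero] at this
    refine this.congr fun d => ?_
    ring
  obtain ⟨d, hdc, hdD, hds, hdg, hd⟩ := ((hcurse e he le_rfl).and_eventually
    (hD.and (hsmall.and ((hgrow.eventually_lt_const hc).and (eventually_ge_atTop 1))))).exists
  have hd0 : (0 : ℝ) < d := by exact_mod_cast hd
  have hle := infoComplexity_le_of_taylor hd hdD (L := fun j => L j d)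
    (fun j hj => (hL j hj d hd).le) hj (B := e / 3) (by positivity) (by
      rw [lt_div_iff₀ (by positivity)] at hds
      refine le_trans (le_of_eq ?_) hds.le
      rw [Real.rpow_add hd0, Real.rpow_natCast, ← Real.sqrt_eq_rpow,
        show √(d : ℝ) * (2 * √d) = 2 * d by rw [mul_left_comm, Real.mul_self_sqrt hd0.le], mul_pow]
      ring)
  rw [mul_div_cancel₀ _ (by norm_num : (3 : ℝ) ≠ 0)] at hle
  have h2 := hdc.trans (ENat.toENNReal_le.2 hle)
  rw [ENat.toENNReal_coe, ENNReal.ofReal_le_iff_le_toReal (ENNReal.natCast_ne_top _),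
    ENNReal.toReal_natCast] at h2
  push_cast at h2
  rw [div_lt_iff₀ (by positivity)] at hdg
  linarith

end CurseIntegration

end

theorem proposition5p4
    (D : ∀ d : ℕ, Set (CurseIntegration.E d))
    (hD : (∀ d, 1 ≤ d → D d = CurseIntegration.openCube d) ∨
      CurseIntegration.ConvexSmallRadius D)
    (k : ℕ) (hk : 1 ≤ k)
    (L : ℕ → ℕ → ℝ) (hL : ∀ j ≤ k, ∀ d, 1 ≤ d → 0 < L j d) :
    (0 < limsup (fun d : ℕ =>
          min ((L 0 d * Real.sqrt d : ℝ) : EReal)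
            (⨅ j ∈ Finset.Icc 1 k, ((L j d * (d : ℝ) : ℝ) : EReal))) atTop →
      CurseIntegration.CurseOfDimensionality D
        (fun d => CurseIntegration.partialClass (D d) k (fun j => L j d))) ∧
    ((∃ j ≤ k, Tendsto (fun d : ℕ => L j d * (d : ℝ) ^ ((j : ℝ) + 1 / 2)) atTop (𝓝 0)) →
      ¬ CurseIntegration.CurseOfDimensionality D
        (fun d => CurseIntegration.partialClass (D d) k (fun j => L j d))) := by
  obtain ⟨ε, q, hε, hq, hq1, hAdm⟩ := CurseIntegration.exists_admissibleDomain D hD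
  refine ⟨fun h => ?_, fun ⟨j, hj, hlim⟩ =>
    CurseIntegration.not_curseOfDimensionality hL hAdm hj hlim⟩
  obtain ⟨δ, hδ, hfreq⟩ := CurseIntegration.exists_frequently_of_limsup_pos h
  refine CurseIntegration.curseOfDimensionality_of_frequently (ε := ε / 3) (by positivity) hq hq1
    hδ ?_ hfreq
  rwa [mul_div_cancel₀ _ (by norm_num : (3 : ℝ) ≠ 0)]
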